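/- Let $\mathcal G=(\mathcal N,\mathcal J)$ be a finite directed network with link capacities $c_{ij}$, and let finitely many source-destination pairs $(s_r,t_r)$ with demands $d_r\ge 0$ be given. Let $\mathcal D=\{t_r\}$ be the set of destinations, let $B$ be the node-arc incidence matrix (the column of link $(u,v)$ has $+1$ at $u$ and $-1$ at $v$), and for $t\in\mathcal D$ let $d^t=\sum_{r:\,t_r=t} d_r\,(e_{s_r}-e_t)$ be the vector of net supplies of the traffic destined to $t$. Each link $(i,j)$ has a utility $V_{ij}$ of its spare capacity, which is strictly concave and continuously differentiable with $V_{ij}'>0$ on its domain $I_{ij}$; here either $I_{ij}=[0,\infty)$, or $I_{ij}=(0,\infty)$ and $V_{ij}'(s)\to\infty$ as $s\downarrow 0$ (for example $V_{ij}=q_{ij}\log s$ with $q_{ij}>0$). The traffic engineering problem TE is $$\max\ \sum_{(i,j)\in\mathcal J}V_{ij}(s_{ij})\quad\text{s.t.}\quad c-\sum_{t\in\mathcal D}f^t=s,\quad s_{ij}\in I_{ij}\ \forall (i,j)\in\mathcal J,\quad Bf^t=d^t,\ f^t\ge 0\ \ \forall t\in\mathcal D,$$ and it is assumed to be feasible.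 An optimal traffic distribution is the vector $f=\sum_{t\in\mathcal D} f^t$ of link loads of an optimal solution of TE. First link weights are vectors $w=(w_{ij})$ of Lagrange multipliers of TE: for some feasible $(s,(f^t)_{t\in\mathcal D})$ and some node potentials $\nu^t$, $t\in\mathcal D$, one has $V_{ij}'(s_{ij})=w_{ij}$ if $s_{ij}>0$, $V_{ij}'(s_{ij})\le w_{ij}$ if $s_{ij}=0$, $\nu^t_j-\nu^t_i=w_{ij}$ if $f^t_{ij}>0$, and $\nu^t_j-\nu^t_i\le w_{ij}$ if $f^t_{ij}=0$. Algorithm 1 (the projected subgradient method on the dual of TE, run without a stopping test), with step sizes $\gamma_k\ge 0$, starts from weights $w^{(0)}$. In step $k$, each link $(i,j)$ chooses a maximizer $s^{(k)}_{ij}$ of $V_{ij}(s)-w^{(k)}_{ij}s$ over $s\in I_{ij}$, each destination $t\in\mathcal D$ chooses a minimizer $f^{t,(k)}$ of $\sum_{(i,j)}w^{(k)}_{ij}f^t_{ij}$ subject to $Bf^t=d^t$, $f^t\ge 0$, and then $$w^{(k+1)}_{ij}=\max\Bigl(0,\ w^{(k)}_{ij}-\gamma_k\bigl(c_{ij}-\textstyle\sum_{t\in\mathcal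 D} f^{t,(k)}_{ij}-s^{(k)}_{ij}\bigr)\Bigr)\qquad\text{for all }(i,j)\in\mathcal J.$$ Then TE has a unique optimal spare capacity vector $s^*$, and: 1. If $\sum_k\gamma_k=\infty$ and $\gamma_k\to 0$, then every infinite sequence of weights $w^{(k)}$ produced by Algorithm 1 (so that all its link and routing problems have the solutions that are chosen) converges to a vector $w^*$ of first link weights. 2. If no link is saturated, i.e. $s^*_{ij}>0$ for all $(i,j)\in\mathcal J$, then there is exactly one vector $w^*$ of first link weights, $s^*_{ij}=(V'_{ij})^{-1}(w^*_{ij})$ for every link, that is, $s^*_{ij}$ is the unique point of $I_{ij}$ at which $V_{ij}'$ takes the value $w^*_{ij}$, and there is exactly one optimal traffic distribution, namely $f^*=c-s^*$. -/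

import Mathlib

open Filter Topology

/-- Admissible utilities: `U` is strictly concave and continuously differentiable on its domain `D`,
with positive derivative `U'`. The domain is `[0, ∞)` or, for a utility that is singular at `0` such
as `q * log s`, the half-line `(0, ∞)` with `U' s → ∞` as `s ↓ 0`. -/
structure IsUtility (D : Set ℝ) (U U' : ℝ → ℝ) : Prop where
  dom : D = Set.Ici 0 ∨ (D = Set.Ioi 0 ∧ Tendsto U' (𝓝[>] 0) atTop)
  deriv : ∀ s ∈ D, HasDerivWithinAt U (U' s) D s
  cont : ContinuousOn U' D
  pos : ∀ s ∈ D, 0 < U' s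
  concave : StrictConcaveOn ℝ D U

/-- The data of a traffic engineering problem: a directed network with vertices `N` and links `J`,
link capacities, source-destination pairs indexed by `R` with their demands, and, for each link, a
utility `V e` of the spare capacity with derivative `V' e` on the domain `dom e`. -/
structure TEProblem (N J R : Type*) where
  src : J → N
  dst : J → N
  cap : J → ℝ
  source : R → N
  sink : R → N
  demand : R → ℝ
  dom : J → Set ℝ
  V : J → ℝ → ℝ
  V' : J → ℝ → ℝ

namespace TEProblem

variable {N J R : Type*} [Fintype N] [DecidableEq N] [Fintype J] [Fintype R]

/-- The set of destination vertices. -/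
def dests (P : TEProblem N J R) : Finset N := Finset.univ.image P.sink

/-- The node-arc incidence matrix. -/
def incidence (P : TEProblem N J R) : Matrix N J ℝ := fun i e =>
  (if i = P.src e then 1 else 0) - (if i = P.dst e then 1 else 0)

/-- The net supply at each vertex of the traffic destined to `t`: every pair with destination `t`
contributes its demand at its source and minus its demand at `t`. -/
def supply (P : TEProblem N J R) (t : N) : N → ℝ := fun i =>
  ∑ r, if P.sink r = t then
    P.demand r * ((if i = P.source r then 1 else 0) - (if i = t then 1 else 0)) else 0

/-- `g` is a nonnegative flow that routes all the traffic destined to `t`. -/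
def IsRouting (P : TEProblem N J R) (t : N) (g : J → ℝ) : Prop :=
  (∀ e, 0 ≤ g e) ∧ (P.incidence).mulVec g = P.supply t

/-- The total load of the flows `f t`, over all destinations `t`, on each link. -/
def load (P : TEProblem N J R) (f : N → J → ℝ) : J → ℝ := fun e => ∑ t ∈ P.dests, f t e

/-- `(s, f)` satisfies the constraints of the problem TE. -/
structure Feasible (P : TEProblem N J R) (s : J → ℝ) (f : N → J → ℝ) : Prop where
  routing : ∀ t ∈ P.dests, P.IsRouting t (f t)
  spare : ∀ e, P.cap e - P.load f e = s e
  mem_dom : ∀ e, s e ∈ P.dom e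

/-- `(s, f)` is an optimal solution of the problem TE. -/
def IsOptimal (P : TEProblem N J R) (s : J → ℝ) (f : N → J → ℝ) : Prop :=
  P.Feasible s f ∧
    ∀ s' f', P.Feasible s' f' → ∑ e, P.V e (s' e) ≤ ∑ e, P.V e (s e)

/-- The spare capacity vector `s` solves TE. -/
def SolvesTE (P : TEProblem N J R) (s : J → ℝ) : Prop := ∃ f, P.IsOptimal s f

/-- `F` is an optimal traffic distribution: the vector of total link loads of a solution of TE. -/
def IsOptimalTraffic (P : TEProblem N J R) (F : J → ℝ) : Prop :=
  ∃ s f, P.IsOptimal s f ∧ F = P.load f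

/-- `w` is a vector of first link weights: the Lagrange multipliers of the capacity constraints of
TE, that is, `w` and node potentials `ν t` satisfy with some feasible `(s, f)` the
Karush-Kuhn-Tucker conditions of TE. -/
def IsFirstWeights (P : TEProblem N J R) (w : J → ℝ) : Prop :=
  ∃ (s : J → ℝ) (f : N → J → ℝ) (ν : N → N → ℝ), P.Feasible s f ∧
    (∀ e, 0 < s e → P.V' e (s e) - w e = 0) ∧
    (∀ e, s e = 0 → P.V' e (s e) - w e ≤ 0) ∧
    (∀ t ∈ P.dests, ∀ e, 0 < f t e → ν t (P.dst e) - ν t (P.src e) - w e = 0) ∧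
    (∀ t ∈ P.dests, ∀ e, f t e = 0 → ν t (P.dst e) - ν t (P.src e) - w e ≤ 0)

/-- `x` is a solution of the link problem: maximize `V e x - ω * x`. -/
def SolvesLink (P : TEProblem N J R) (e : J) (ω x : ℝ) : Prop :=
  x ∈ P.dom e ∧ ∀ y ∈ P.dom e, P.V e y - ω * y ≤ P.V e x - ω * x

/-- `g` is a solution of the routing problem of destination `t`: a minimum cost flow, without
capacities, for the link costs `w`. -/
def SolvesRoute (P : TEProblem N J R) (t : N) (w g : J → ℝ) : Prop :=
  P.IsRouting t g ∧ ∀ g', P.IsRouting t g' → ∑ e, w e * g e ≤ ∑ e, w e * g' e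

/-- `w`, `s`, `f` are the weights, spare capacities and flows of an infinite run, with step sizes
`γ`, of the projected subgradient algorithm on the dual of TE. -/
structure IsRun (P : TEProblem N J R) (γ : ℕ → ℝ) (w s : ℕ → J → ℝ) (f : ℕ → N → J → ℝ) :
    Prop where
  link : ∀ k e, P.SolvesLink e (w k e) (s k e)
  route : ∀ k, ∀ t ∈ P.dests, P.SolvesRoute t (w k) (f k t)
  update : ∀ k e,
    w (k + 1) e = max (w k e - γ k * (P.cap e - P.load (f k) e - s k e)) 0

end TEProblem

/-!
TE is a concave maximization problem with linear constraints. Its optimal spare capacities `s₀`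
exist by compactness, once links with a singular utility are shown to keep some capacity free, and
they are unique by strict concavity. Farkas' lemma turns the first-order conditions at an optimal
solution `(s₀, f₀)` into multipliers. In dual terms (`IsEquilibrium`), first link weights are the
prices `w` that satisfy the first-order conditions of the link problems at `s₀`, and for which the
flows `f₀` are cheapest routings. If no link is saturated, they are the marginal utilities at `s₀`,
which gives the uniqueness in the second part.

For the convergence of the algorithm note first that link problems are solvable only at positive
prices, so that the projection is never active, and that the subgradients of a run are eventually
bounded. The dual optimal prices form a polyhedron `W`: whether `f₀` is a cheapest routing can be
tested with finitely many routings, since the cheapest routings form a face of the polyhedron of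
all routings (`exists_test_routings`). By Hoffman's error bound, prices whose optimality gap is
small are close to `W`, even if `W` is unbounded. Hence the usual estimate for subgradient steps shows
that the distance to `W`, and with it the gap, tends to zero
(`tendsto_infDist_of_subgradient_steps`).

The step sizes need not be square-summable, so this does not exclude a drift along `W`. What
excludes it is that a step is a combination of the normals of the inequalities of `W` that are
nearly tight at the current prices: a link contributes only if its spare capacity differs from `s₀`,
and a routing contributes only differences `f₀ t - h` to test routings `h` that are cheapest at the
current prices. A sequence with such steps, tending to zero, is Cauchy
(`cauchySeq_of_steps_mem_span_tight`): as long as the nearly tight inequalities remain the same, it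
moves in the span of their normals, on which the tightness pins it down, and when one of them is no
longer tight, no new one has become tight meanwhile.
-/

/-! ### Farkas' lemma -/

section Farkas

/-- **Farkas' lemma** for finitely many linear functionals on a real vector space. -/
theorem farkas {ι E : Type*} [AddCommGroup E] [Module ℝ E] (s : Finset ι) (a : ι → E →ₗ[ℝ] ℝ)
    (b : E →ₗ[ℝ] ℝ) (h : ∀ x, (∀ i ∈ s, a i x ≤ 0) → b x ≤ 0) :
    ∃ c : ι → ℝ, (∀ i, 0 ≤ c i) ∧ ∀ x, b x = ∑ i ∈ s, c i * a i x := by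
  classical
  induction s using Finset.induction_on generalizing a b with
  | empty =>
    refine ⟨0, fun _ => le_rfl, fun x => ?_⟩
    have h1 := h x (by simp)
    have h2 := h (-x) (by simp)
    rw [map_neg] at h2
    simp only [Finset.sum_empty]
    linarith
  | insert j s hj ih =>
    by_cases hs : ∀ x, (∀ i ∈ s, a i x ≤ 0) → b x ≤ 0
    · obtain ⟨c, hc, hb⟩ := ih a b hs
      refine ⟨Function.update c j 0, fun i => ?_, fun x => ?_⟩
      · by_cases hi : i = j
        · simp [hi]
        · simp [hi, hc i]
      · rw [Finset.sum_insert hj, hb x]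
        simp only [Function.update_self, zero_mul, zero_add]
        refine Finset.sum_congr rfl fun i hi => ?_
        rw [Function.update_of_ne (ne_of_mem_of_not_mem hi hj)]
    · push Not at hs
      obtain ⟨y, hy, hby⟩ := hs
      have hjy : 0 < a j y := by
        by_contra hn
        refine absurd (h y fun i hi => ?_) (not_le.2 hby)
        rcases Finset.mem_insert.1 hi with rfl | hi
        · exact not_lt.1 hn
        · exact hy i hi
      -- Project along `y` onto the kernel of `a j` to eliminate the functional `a j`.
      obtain ⟨c, hc, hb⟩ := ih (fun i => a i - (a i y / a j y) • a j) (b - (b y / a j y) • a j) (by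
        intro x hx
        have := h (x - (a j x / a j y) • y) (by
          intro i hi
          rcases Finset.mem_insert.1 hi with rfl | hi
          · simp [hjy.ne']
          · have := hx i hi
            simp only [LinearMap.sub_apply, LinearMap.smul_apply, smul_eq_mul] at this
            simp only [map_sub, map_smul, smul_eq_mul]
            calc _ = a i x - a i y / a j y * a j x := by ring
              _ ≤ 0 := this)
        simp only [map_sub, map_smul, smul_eq_mul] at this
        simp only [LinearMap.sub_apply, LinearMap.smul_apply, smul_eq_mul]
        calc _ = b x - a j x / a j y * b y := by ring
          _ ≤ 0 := this)
      refine ⟨Function.update c j (b y / a j y - ∑ i ∈ s, c i * (a i y / a j y)),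
        fun i => ?_, fun x => ?_⟩
      · by_cases hi : i = j
        · subst hi
          rw [Function.update_self]
          have h1 : ∑ l ∈ s, c l * (a l y / a i y) ≤ 0 :=
            Finset.sum_nonpos fun l hl =>
              mul_nonpos_of_nonneg_of_nonpos (hc l)
                (div_nonpos_of_nonpos_of_nonneg (hy l hl) hjy.le)
          have h2 : 0 < b y / a i y := div_pos hby hjy
          linarith
        · simp [hi, hc i]
      · rw [Finset.sum_insert hj]
        have h1 : ∑ i ∈ s, Function.update c j
            (b y / a j y - ∑ i ∈ s, c i * (a i y / a j y)) i * a i x = ∑ i ∈ s, c i * a i x :=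
          Finset.sum_congr rfl fun i hi => by
            rw [Function.update_of_ne (ne_of_mem_of_not_mem hi hj)]
        have h2 := hb x
        simp only [LinearMap.sub_apply, LinearMap.smul_apply, smul_eq_mul, mul_sub,
          Finset.sum_sub_distrib] at h2
        have h3 : ∑ i ∈ s, c i * (a i y / a j y * a j x) =
            (∑ i ∈ s, c i * (a i y / a j y)) * a j x := by
          rw [Finset.sum_mul]
          exact Finset.sum_congr rfl fun i _ => by ring
        rw [h1, Function.update_self, sub_mul]
        linarith

/-- Farkas' lemma for a system of finitely many linear inequalities and equations. -/
theorem farkas_of_equations {ι κ E : Type*} [Fintype ι] [Fintype κ] [AddCommGroup E] [Module ℝ E]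
    (a : ι → E →ₗ[ℝ] ℝ) (L : κ → E →ₗ[ℝ] ℝ) (b : E →ₗ[ℝ] ℝ)
    (h : ∀ x, (∀ i, a i x ≤ 0) → (∀ j, L j x = 0) → b x ≤ 0) :
    ∃ (c : ι → ℝ) (ν : κ → ℝ), (∀ i, 0 ≤ c i) ∧
      ∀ x, b x = ∑ i, c i * a i x + ∑ j, ν j * L j x := by
  obtain ⟨c, hc, hb⟩ := farkas Finset.univ
    (Sum.elim a (Sum.elim L fun j => -L j) : ι ⊕ (κ ⊕ κ) → E →ₗ[ℝ] ℝ) b (by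
      intro x hx
      refine h x (fun i => hx (Sum.inl i) (Finset.mem_univ _)) fun j => le_antisymm ?_ ?_
      · exact hx (Sum.inr (Sum.inl j)) (Finset.mem_univ _)
      · have := hx (Sum.inr (Sum.inr j)) (Finset.mem_univ _)
        simpa using this)
  refine ⟨fun i => c (Sum.inl i), fun j => c (Sum.inr (Sum.inl j)) - c (Sum.inr (Sum.inr j)),
    fun i => hc _, fun x => ?_⟩
  rw [hb x, Fintype.sum_sum_type, Fintype.sum_sum_type]
  simp only [Sum.elim_inl, Sum.elim_inr, LinearMap.neg_apply, sub_mul, mul_neg,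
    Finset.sum_sub_distrib, Finset.sum_neg_distrib]
  ring

end Farkas

/-! ### Bounds over finite families -/

theorem exists_pos_forall_le {ι : Type*} [Finite ι] (f : ι → ℝ) (hf : ∀ i, 0 < f i) :
    ∃ c, 0 < c ∧ ∀ i, c ≤ f i := by
  rcases isEmpty_or_nonempty ι with h | h
  · exact ⟨1, one_pos, fun i => h.elim i⟩
  · obtain ⟨i, hi⟩ := Finite.exists_min f
    exact ⟨f i, hf i, hi⟩

theorem exists_forall_le_of_finite {ι : Type*} [Finite ι] (f : ι → ℝ) :
    ∃ C, 0 < C ∧ ∀ i, f i ≤ C := by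
  obtain ⟨C, hC⟩ := (Set.finite_range f).bddAbove
  exact ⟨max C 1, lt_max_of_lt_right one_pos,
    fun i => (hC (Set.mem_range_self i)).trans (le_max_left _ _)⟩

/-! ### Error bounds and steps in the span of tight constraints -/

section Polyhedra

variable {ι E : Type*} [Finite ι] [NormedAddCommGroup E] [InnerProductSpace ℝ E]
  [FiniteDimensional ℝ E]

open scoped RealInnerProductSpace

/-- **Hoffman's error bound**: the distance to a nonempty polyhedron is at most a constant times
the largest violation of its inequalities. -/
theorem hoffman_bound (a : ι → E) (b : ι → ℝ) (hne : ∃ x, ∀ i, ⟪a i, x⟫ ≤ b i) :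
    ∃ C > 0, ∀ x δ, 0 ≤ δ → (∀ i, ⟪a i, x⟫ ≤ b i + δ) →
      ∃ p, (∀ i, ⟪a i, p⟫ ≤ b i) ∧ ‖x - p‖ ≤ C * δ := by
  classical
  have := Fintype.ofFinite ι
  set Q : Set E := {x | ∀ i, ⟪a i, x⟫ ≤ b i} with hQ
  have hclosed : IsClosed Q := by
    simp only [hQ, Set.ofPred_forall]
    exact isClosed_iInter fun i => isClosed_le (by fun_prop) continuous_const
  have hconv : Convex ℝ Q := by
    intro x hx y hy s t hs ht hst i
    rw [inner_add_right, inner_smul_right, inner_smul_right]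
    calc s * ⟪a i, x⟫ + t * ⟪a i, y⟫ ≤ s * b i + t * b i :=
          add_le_add (mul_le_mul_of_nonneg_left (hx i) hs) (mul_le_mul_of_nonneg_left (hy i) ht)
      _ = b i := by rw [← add_mul, hst, one_mul]
  -- Points of `Q` with the same active set `A` have the same normal cone, on whose unit sphere the
  -- active constraints grow at a uniform rate.
  have key : ∀ A : Set ι, ∃ C > 0, ∀ p u, p ∈ Q → {i | ⟪a i, p⟫ = b i} = A →
      (∀ y ∈ Q, ⟪u, y - p⟫ ≤ 0) → ∀ δ, 0 ≤ δ → (∀ i ∈ A, ⟪a i, u⟫ ≤ δ) → ‖u‖ ≤ C * δ := by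
    intro A
    by_cases hA : ∃ p ∈ Q, {i | ⟪a i, p⟫ = b i} = A
    swap
    · exact ⟨1, one_pos, fun p u hp hpA => absurd ⟨p, hp, hpA⟩ hA⟩
    obtain ⟨q, hq, hqA⟩ := hA
    have active : ∀ i ∈ A, ⟪a i, q⟫ = b i := fun i hi => by rw [← hqA] at hi; exact hi
    -- A direction that increases no constraint active at a point stays in `Q` for a while.
    have move : ∀ p ∈ Q, {i | ⟪a i, p⟫ = b i} = A → ∀ v, (∀ i ∈ A, ⟪a i, v⟫ ≤ 0) →
        ∃ r : ℝ, 0 < r ∧ p + r • v ∈ Q := by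
      intro p hp hpA v hv
      have : ∀ i, ∀ᶠ r in 𝓝[>] (0 : ℝ), ⟪a i, p + r • v⟫ ≤ b i := by
        intro i
        by_cases hi : i ∈ A
        · have hi' : ⟪a i, p⟫ = b i := by rw [← hpA] at hi; exact hi
          filter_upwards [self_mem_nhdsWithin] with r hr
          rw [inner_add_right, inner_smul_right, hi']
          have := mul_nonpos_of_nonneg_of_nonpos (le_of_lt hr) (hv i hi)
          linarith
        · have hi' : ⟪a i, p⟫ < b i := lt_of_le_of_ne (hp i) fun h => hi (hpA ▸ h)
          have hc : Continuous fun r : ℝ => ⟪a i, p + r • v⟫ := by fun_prop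
          have : Tendsto (fun r : ℝ => ⟪a i, p + r • v⟫) (𝓝[>] 0) (𝓝 ⟪a i, p⟫) := by
            have := hc.tendsto 0
            simp only [zero_smul, add_zero] at this
            exact this.mono_left nhdsWithin_le_nhds
          exact (this.eventually_lt_const hi').mono fun r hr => hr.le
      obtain ⟨r, hr, hr0⟩ := ((eventually_all.2 this).and self_mem_nhdsWithin).exists
      exact ⟨r, hr0, hr⟩
    have normal : ∀ p u, p ∈ Q → {i | ⟪a i, p⟫ = b i} = A → (∀ y ∈ Q, ⟪u, y - p⟫ ≤ 0) →
        ∀ y ∈ Q, ⟪u, y - q⟫ ≤ 0 := by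
      intro p u hp hpA hu y hy
      obtain ⟨r, hr, hrQ⟩ := move p hp hpA (y - q) fun i hi => by
        rw [inner_sub_right, active i hi]; linarith [hy i]
      have := hu _ hrQ
      rw [add_sub_cancel_left, inner_smul_right] at this
      exact nonpos_of_mul_nonpos_right this hr
    set U : Set E := {u | ‖u‖ = 1 ∧ ∀ y ∈ Q, ⟪u, y - q⟫ ≤ 0} with hU
    have hUc : IsCompact U := by
      refine (isCompact_sphere (0 : E) 1).of_isClosed_subset ?_ fun u hu => by simpa using hu.1
      refine (isClosed_eq continuous_norm continuous_const).inter
        (s₂ := {u | ∀ y ∈ Q, ⟪u, y - q⟫ ≤ 0}) ?_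
      simp only [Set.ofPred_forall]
      exact isClosed_iInter fun y => isClosed_iInter fun _ =>
        isClosed_le (by fun_prop) continuous_const
    -- The growth rate is the minimum over `U` of `∑ i ∈ A, (⟪a i, u⟫)⁺`.
    set φ : E → ℝ := fun u => ∑ i, if i ∈ A then max ⟪a i, u⟫ 0 else 0 with hφ
    have hφc : Continuous φ := by
      refine continuous_finsetSum _ fun i _ => ?_
      split_ifs
      · exact (by fun_prop : Continuous fun u => ⟪a i, u⟫).max continuous_const
      · exact continuous_const
    have hφpos : ∀ u ∈ U, 0 < φ u := by
      intro u hu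
      have hnn : ∀ i ∈ Finset.univ, 0 ≤ (if i ∈ A then max ⟪a i, u⟫ 0 else 0) := by
        intro i _; split_ifs <;> simp
      refine lt_of_le_of_ne (Finset.sum_nonneg hnn) fun h0 => ?_
      have h1 := (Finset.sum_eq_zero_iff_of_nonneg hnn).1 h0.symm
      obtain ⟨r, hr, hrQ⟩ := move q hq hqA u fun i hi => by
        have := h1 i (Finset.mem_univ i)
        rw [if_pos hi] at this
        exact max_eq_right_iff.1 this
      have := hu.2 _ hrQ
      rw [add_sub_cancel_left, inner_smul_right, real_inner_self_eq_norm_sq, hu.1] at this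
      linarith
    obtain ⟨m, hm, hmU⟩ : ∃ m, 0 < m ∧ ∀ u ∈ U, m ≤ φ u := by
      rcases U.eq_empty_or_nonempty with h | h
      · exact ⟨1, one_pos, fun u hu => by simp [h] at hu⟩
      · obtain ⟨u, hu, hmin⟩ := hUc.exists_isMinOn h hφc.continuousOn
        exact ⟨φ u, hφpos u hu, fun v hv => hmin hv⟩
    refine ⟨(Fintype.card ι + 1) / m, by positivity, fun p u hp hpA hu δ hδ hle => ?_⟩
    rcases eq_or_ne u 0 with rfl | hu0
    · rw [norm_zero]; positivity
    have hun : 0 < ‖u‖ := norm_pos_iff.2 hu0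
    have h1 : (‖u‖⁻¹ • u) ∈ U := by
      refine ⟨by rw [norm_smul, norm_inv, norm_norm, inv_mul_cancel₀ hun.ne'], fun y hy => ?_⟩
      rw [real_inner_smul_left]
      exact mul_nonpos_of_nonneg_of_nonpos (by positivity) (normal p u hp hpA hu y hy)
    have h2 : φ (‖u‖⁻¹ • u) ≤ ∑ _i : ι, ‖u‖⁻¹ * δ := by
      refine Finset.sum_le_sum fun i _ => ?_
      split_ifs with hi
      · rw [inner_smul_right]
        exact max_le (mul_le_mul_of_nonneg_left (hle i hi) (by positivity)) (by positivity)
      · positivity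
    have h3 := (hmU _ h1).trans h2
    rw [Finset.sum_const, nsmul_eq_mul, Finset.card_univ] at h3
    rw [div_mul_eq_mul_div, le_div_iff₀ hm]
    calc ‖u‖ * m ≤ ‖u‖ * (Fintype.card ι * (‖u‖⁻¹ * δ)) := by gcongr
      _ = Fintype.card ι * δ := by field_simp
      _ ≤ (Fintype.card ι + 1) * δ := by nlinarith
  choose C hC hbound using key
  obtain ⟨M, hM, hCM⟩ := exists_forall_le_of_finite C
  refine ⟨M, hM, fun x δ hδ hx => ?_⟩
  obtain ⟨p, hp, hmin⟩ := exists_norm_eq_iInf_of_complete_convex hne hclosed.isComplete hconv x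
  have hvar := (norm_eq_iInf_iff_real_inner_le_zero hconv hp).1 hmin
  refine ⟨p, hp, (hbound _ p (x - p) hp rfl hvar δ hδ fun i hi => ?_).trans
    (mul_le_mul_of_nonneg_right (hCM _) hδ)⟩
  have hi' : ⟪a i, p⟫ = b i := hi
  rw [inner_sub_right, hi']
  linarith [hx i]

/-- On the span of finitely many vectors a vector is controlled by its inner products with them. -/
theorem exists_norm_le_of_mem_span (a : ι → E) :
    ∃ C > 0, ∀ (T : Set ι) (u : E) (δ : ℝ), 0 ≤ δ → u ∈ Submodule.span ℝ (a '' T) →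
      (∀ i ∈ T, |⟪a i, u⟫| ≤ δ) → ‖u‖ ≤ C * δ := by
  classical
  have := Fintype.ofFinite ι
  have key : ∀ T : Set ι, ∃ C : ℝ, ∀ (u : E) (δ : ℝ), 0 ≤ δ → u ∈ Submodule.span ℝ (a '' T) →
      (∀ i ∈ T, |⟪a i, u⟫| ≤ δ) → ‖u‖ ≤ C * δ := by
    intro T
    let φ : Submodule.span ℝ (a '' T) →ₗ[ℝ] (T → ℝ) :=
      LinearMap.pi fun i => (innerₛₗ ℝ (a i)).comp (Submodule.subtype _)
    have hφ : LinearMap.ker φ = ⊥ := by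
      rw [LinearMap.ker_eq_bot']
      rintro ⟨u, hu⟩ h0
      have h1 : ∀ i ∈ T, ⟪a i, u⟫ = 0 := fun i hi => congrFun h0 ⟨i, hi⟩
      have h2 : ∀ v ∈ Submodule.span ℝ (a '' T), ⟪v, u⟫ = 0 := by
        intro v hv
        induction hv using Submodule.span_induction with
        | mem v hv => obtain ⟨i, hi, rfl⟩ := hv; exact h1 i hi
        | zero => exact inner_zero_left _
        | add v w _ _ hv hw => rw [inner_add_left, hv, hw, add_zero]
        | smul c v _ hv => rw [real_inner_smul_left, hv, mul_zero]
      exact Subtype.ext (inner_self_eq_zero.1 (h2 u hu))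
    obtain ⟨K, -, hK⟩ := φ.exists_antilipschitzWith hφ
    refine ⟨K, fun u δ hδ hu hi => ?_⟩
    have h1 := hK.le_mul_norm (map_zero φ) ⟨u, hu⟩
    refine h1.trans (mul_le_mul_of_nonneg_left ?_ K.2)
    exact (pi_norm_le_iff_of_nonneg hδ).2 fun i => hi i i.2
  choose C hC using key
  obtain ⟨M, hM, hCM⟩ := exists_forall_le_of_finite C
  exact ⟨M, hM, fun T u δ hδ hu hi =>
    (hC T u δ hδ hu hi).trans (mul_le_mul_of_nonneg_right (hCM T) hδ)⟩

/-- A sequence with vanishing steps is Cauchy if, for a finite family of affine functions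
`⟪a i, ·⟫ - b i`, each step eventually lies in the span of those `a i` whose functions are
arbitrarily small at the current point. -/
theorem cauchySeq_of_steps_mem_span_tight (a : ι → E) (b : ι → ℝ) (x : ℕ → E)
    (hstep : Tendsto (fun k => ‖x (k + 1) - x k‖) atTop (𝓝 0))
    (hspan : ∀ ε > 0, ∀ᶠ k in atTop,
      x (k + 1) - x k ∈ Submodule.span ℝ (a '' {i | |⟪a i, x k⟫ - b i| ≤ ε})) :
    CauchySeq x := by
  classical
  have := Fintype.ofFinite ι
  obtain ⟨C, hC, hCb⟩ := exists_norm_le_of_mem_span a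
  obtain ⟨A, hA, hAb⟩ := exists_forall_le_of_finite fun i => ‖a i‖
  let T : ℝ → ℕ → Finset ι := fun ε k => {i | |⟪a i, x k⟫ - b i| ≤ ε}
  have memT : ∀ ε k i, i ∈ T ε k ↔ |⟪a i, x k⟫ - b i| ≤ ε := fun ε k i => by simp [T]
  have hspan' : ∀ ε > 0, ∀ᶠ k in atTop,
      x (k + 1) - x k ∈ Submodule.span ℝ (a '' (T ε k : Set ι)) := by
    intro ε hε
    filter_upwards [hspan ε hε] with k hk
    convert hk using 4
    simp [T]
  -- Induction on the number of functions that are small at `x k`. As long as all of them remain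
  -- small at a much finer scale, the sequence moves only in their span, hence hardly at all; once
  -- one of them ceases to be small, fewer are left and no new one can have become small.
  have key : ∀ n : ℕ, ∀ M > 0, ∃ ε > 0, ε ≤ M ∧ ∃ K, ∀ k ≥ K, (T ε k).card ≤ n →
      ∀ l ≥ k, ‖x l - x k‖ ≤ M := by
    intro n
    induction n with
    | zero =>
      intro M hM
      obtain ⟨K, hK⟩ := eventually_atTop.1 (hspan' M hM)
      refine ⟨M, hM, le_rfl, K, fun k hk hcard l hl => ?_⟩
      have h0 : T M k = ∅ := Finset.card_eq_zero.1 (Nat.le_zero.1 hcard)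
      have : x l = x k := by
        induction l, hl using Nat.le_induction with
        | base => rfl
        | succ l hl ih =>
          have h1 := hK l (hk.trans hl)
          have h2 : T M l = ∅ := by rw [← h0]; ext i; rw [memT, memT, ih]
          rw [h2] at h1
          simp only [Finset.coe_empty, Set.image_empty, Submodule.span_empty,
            Submodule.mem_bot] at h1
          rw [sub_eq_zero.1 h1, ih]
      rw [this, sub_self, norm_zero]
      exact hM.le
    | succ n ih =>
      intro M hM
      -- While the functions remain small at scale `ε`, the sequence moves by at most
      -- `(2 * C + 1) * ε`, which changes them by at most `A * (2 * C + 1) * ε`. The factor `D`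
      -- bounds the resulting ratios of the coarse scale, and of the displacement, to `ε`.
      set D : ℝ := 2 * (1 + A) * (1 + (2 * C + 1)) with hD
      have hD1 : 1 + A * (2 * C + 1) ≤ D := by nlinarith [mul_pos hA hC]
      have hD2 : 2 * C + 1 + 1 ≤ D := by nlinarith [mul_pos hA hC]
      have hDpos : 0 < D := by positivity
      obtain ⟨ε, hε, hεM, K₀, hK₀⟩ := ih (M / D) (by positivity)
      have hεD : ε * D ≤ M := (le_div_iff₀ hDpos).1 hεM
      obtain ⟨K₁, hK₁⟩ := eventually_atTop.1 (hspan' ε hε)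
      obtain ⟨K₂, hK₂⟩ := eventually_atTop.1 (hstep.eventually_le_const hε)
      refine ⟨ε * (1 + A * (2 * C + 1)), by positivity,
        (mul_le_mul_of_nonneg_left hD1 hε.le).trans hεD, max K₀ (max K₁ K₂),
        fun k hk hcard => ?_⟩
      have hk0 : K₀ ≤ k := (le_max_left _ _).trans hk
      have hk1 : K₁ ≤ k := (le_max_left _ _).trans ((le_max_right _ _).trans hk)
      have hk2 : K₂ ≤ k := (le_max_right _ _).trans ((le_max_right _ _).trans hk)
      set S := T (ε * (1 + A * (2 * C + 1))) k with hS
      have near : ∀ l, ‖x l - x k‖ ≤ (2 * C + 1) * ε → T ε l ⊆ S := by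
        intro l hl i hi
        rw [memT] at hi
        rw [hS, memT]
        have h1 : |⟪a i, x l - x k⟫| ≤ A * ((2 * C + 1) * ε) :=
          (abs_real_inner_le_norm _ _).trans
            (mul_le_mul (hAb i) hl (norm_nonneg _) hA.le)
        have h2 : ⟪a i, x k⟫ - b i = (⟪a i, x l⟫ - b i) - ⟪a i, x l - x k⟫ := by
          rw [inner_sub_right]; ring
        rw [h2]
        calc _ ≤ |⟪a i, x l⟫ - b i| + |⟪a i, x l - x k⟫| := abs_sub _ _
          _ ≤ ε + A * ((2 * C + 1) * ε) := add_le_add hi h1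
          _ = _ := by ring
      have drop : ∀ l, ‖x l - x k‖ ≤ (2 * C + 1) * ε → ¬ S ⊆ T ε l → (T ε l).card ≤ n := by
        intro l hl hnot
        have := Finset.card_lt_card (Finset.ssubset_iff_subset_ne.2
          ⟨near l hl, fun h => hnot h.ge⟩)
        omega
      have finish : ∀ j l, k ≤ j → j ≤ l → ‖x j - x k‖ ≤ (2 * C + 1) * ε →
          ¬ S ⊆ T ε j → ‖x l - x k‖ ≤ M := by
        intro j l hkj hjl hj hnot
        have h1 := hK₀ j (hk0.trans hkj) (drop j hj hnot) l hjl
        calc ‖x l - x k‖ = ‖(x l - x j) + (x j - x k)‖ := by congr 1; abel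
          _ ≤ ‖x l - x j‖ + ‖x j - x k‖ := norm_add_le _ _
          _ ≤ M / D + (2 * C + 1) * (M / D) :=
              add_le_add h1 (hj.trans (mul_le_mul_of_nonneg_left hεM (by positivity)))
          _ = (M / D) * (2 * C + 1 + 1) := by ring
          _ ≤ (M / D) * D := mul_le_mul_of_nonneg_left hD2 (by positivity)
          _ = M := div_mul_cancel₀ _ hDpos.ne'
      have self : ‖x k - x k‖ ≤ (2 * C + 1) * ε := by rw [sub_self, norm_zero]; positivity
      by_cases hk' : S ⊆ T ε k
      swap
      · exact fun l hl => finish k l le_rfl hl self hk'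
      have stay : ∀ l, x l - x k ∈ Submodule.span ℝ (a '' (S : Set ι)) → S ⊆ T ε l →
          ‖x l - x k‖ ≤ 2 * C * ε := by
        intro l hmem hsub
        calc _ ≤ C * (2 * ε) := by
              refine hCb S _ (2 * ε) (by positivity) hmem fun i hi => ?_
              have h1 := (memT _ _ _).1 (hsub hi)
              have h2 := (memT _ _ _).1 (hk' hi)
              have h3 : ⟪a i, x l - x k⟫ = (⟪a i, x l⟫ - b i) - (⟪a i, x k⟫ - b i) := by
                rw [inner_sub_right]; ring
              rw [h3]
              exact (abs_sub _ _).trans (by linarith)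
          _ = _ := by ring
      have dich : ∀ l ≥ k, (x l - x k ∈ Submodule.span ℝ (a '' (S : Set ι)) ∧ S ⊆ T ε l) ∨
          ∃ j, k ≤ j ∧ j ≤ l ∧ ‖x j - x k‖ ≤ (2 * C + 1) * ε ∧ ¬ S ⊆ T ε j := by
        intro l hl
        induction l, hl using Nat.le_induction with
        | base => exact Or.inl ⟨by rw [sub_self]; exact zero_mem _, hk'⟩
        | succ l hl ih =>
          rcases ih with ⟨hmem, hsub⟩ | ⟨j, hj⟩
          swap
          · exact Or.inr ⟨j, hj.1, hj.2.1.trans (Nat.le_succ l), hj.2.2⟩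
          have h1 := stay l hmem hsub
          have h2 : T ε l ⊆ S := near l (h1.trans (by nlinarith))
          have h3 : x (l + 1) - x l ∈ Submodule.span ℝ (a '' (S : Set ι)) :=
            Submodule.span_mono (Set.image_mono (Finset.coe_subset.2 h2)) (hK₁ l (hk1.trans hl))
          have h4 : x (l + 1) - x k = (x (l + 1) - x l) + (x l - x k) := by abel
          have h5 : ‖x (l + 1) - x k‖ ≤ (2 * C + 1) * ε := by
            rw [h4]
            refine (norm_add_le _ _).trans ?_
            have := hK₂ l (hk2.trans hl)
            linarith
          by_cases h6 : S ⊆ T ε (l + 1)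
          · exact Or.inl ⟨h4 ▸ add_mem h3 hmem, h6⟩
          · exact Or.inr ⟨l + 1, hl.trans (Nat.le_succ l), le_rfl, h5, h6⟩
      intro l hl
      rcases dich l hl with ⟨hmem, hsub⟩ | ⟨j, hkj, hjl, hj, hnot⟩
      · calc _ ≤ 2 * C * ε := stay l hmem hsub
          _ ≤ ε * D := by nlinarith
          _ ≤ M := hεD
      · exact finish j l hkj hjl hj hnot
  rw [Metric.cauchySeq_iff']
  intro ε hε
  obtain ⟨ε', -, -, K, hK⟩ := key (Fintype.card ι) (ε / 2) (by positivity)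
  refine ⟨K, fun l hl => ?_⟩
  rw [dist_eq_norm]
  exact (hK K le_rfl (Finset.card_le_univ _) l hl).trans_lt (by linarith)

end Polyhedra

/-! ### Subgradient steps -/

section Subgradient

open scoped RealInnerProductSpace
open Metric

variable {E : Type*} [NormedAddCommGroup E] [InnerProductSpace ℝ E] [ProperSpace E]

/-- Convergence of the subgradient method to the solution set `W` in distance, for steps that
tend to zero and have a divergent sum. The optimality gap `gap k` of `x k` is assumed to be bounded
away from zero as long as `x k` is bounded away from `W`. -/
theorem tendsto_infDist_of_subgradient_steps {W : Set E} (hW : IsClosed W) (hne : W.Nonempty)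
    {x g : ℕ → E} {γ gap : ℕ → ℝ} {G : ℝ} (hγ : ∀ k, 0 ≤ γ k)
    (hsum : Tendsto (fun n => ∑ k ∈ Finset.range n, γ k) atTop atTop)
    (hγ0 : Tendsto γ atTop (𝓝 0)) (hx : ∀ k, x (k + 1) = x k - γ k • g k)
    (hG : ∀ᶠ k in atTop, ‖g k‖ ≤ G) (hsub : ∀ k, ∀ p ∈ W, gap k ≤ ⟪g k, x k - p⟫)
    (hgrowth : ∀ δ > 0, ∃ η > 0, ∀ k, gap k ≤ η → infDist (x k) W ≤ δ) :
    Tendsto (fun k => infDist (x k) W) atTop (𝓝 0) := by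
  have hrec : ∀ k, ‖g k‖ ≤ G →
      infDist (x (k + 1)) W ^ 2 ≤ infDist (x k) W ^ 2 - 2 * γ k * gap k + γ k ^ 2 * G ^ 2 := by
    intro k hk
    obtain ⟨p, hp, hpd⟩ := hW.exists_infDist_eq_dist hne (x k)
    have h1 : infDist (x (k + 1)) W ^ 2 ≤ ‖x (k + 1) - p‖ ^ 2 := by
      rw [← dist_eq_norm]
      exact pow_le_pow_left₀ infDist_nonneg (infDist_le_dist_of_mem hp) 2
    have h2 : x (k + 1) - p = (x k - p) - γ k • g k := by rw [hx]; abel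
    rw [h2, norm_sub_sq_real, inner_smul_right, norm_smul, mul_pow, Real.norm_eq_abs, sq_abs,
      real_inner_comm, ← dist_eq_norm, ← hpd] at h1
    have h3 := mul_le_mul_of_nonneg_left (hsub k p hp) (hγ k)
    have h4 : γ k ^ 2 * ‖g k‖ ^ 2 ≤ γ k ^ 2 * G ^ 2 := by gcongr
    linarith
  have hstep : ∀ k, ‖g k‖ ≤ G → infDist (x (k + 1)) W ≤ infDist (x k) W + γ k * G := by
    intro k hk
    refine infDist_le_infDist_add_dist.trans (add_le_add_right ?_ _)
    rw [hx, dist_eq_norm, sub_sub_cancel_left, norm_neg, norm_smul, Real.norm_eq_abs,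
      abs_of_nonneg (hγ k)]
    exact mul_le_mul_of_nonneg_left hk (hγ k)
  rw [tendsto_order]
  refine ⟨fun c hc => Eventually.of_forall fun k => hc.trans_le infDist_nonneg, fun c hc => ?_⟩
  obtain ⟨η, hη, hgr⟩ := hgrowth (c / 3) (by positivity)
  have e1 : ∀ᶠ k in atTop, γ k * G ^ 2 ≤ η := by
    have : Tendsto (fun k => γ k * G ^ 2) atTop (𝓝 0) := by simpa using hγ0.mul_const (G ^ 2)
    exact this.eventually_le_const hη
  have e2 : ∀ᶠ k in atTop, γ k * G ≤ c / 3 := by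
    have : Tendsto (fun k => γ k * G) atTop (𝓝 0) := by simpa using hγ0.mul_const G
    exact this.eventually_le_const (by positivity)
  obtain ⟨K, hK⟩ := eventually_atTop.1 (hG.and (e1.and e2))
  have decr : ∀ k ≥ K, η < gap k →
      infDist (x (k + 1)) W ^ 2 ≤ infDist (x k) W ^ 2 - γ k * η := by
    intro k hk hgap
    obtain ⟨a1, a2, -⟩ := hK k hk
    have h1 := hrec k a1
    have h2 := mul_le_mul_of_nonneg_left a2 (hγ k)
    have h3 := mul_le_mul_of_nonneg_left hgap.le (hγ k)
    nlinarith
  obtain ⟨m, hm, hgm⟩ : ∃ m ≥ K, gap m ≤ η := by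
    by_contra! hcon
    have h1 : ∀ n ≥ K, infDist (x n) W ^ 2 + η * ∑ k ∈ Finset.range n, γ k ≤
        infDist (x K) W ^ 2 + η * ∑ k ∈ Finset.range K, γ k := by
      intro n hn
      induction n, hn using Nat.le_induction with
      | base => exact le_rfl
      | succ n hn ih =>
        have := decr n hn (hcon n hn)
        rw [Finset.sum_range_succ]
        linarith
    obtain ⟨n, hn⟩ := ((hsum.const_mul_atTop hη).eventually_gt_atTop
      (infDist (x K) W ^ 2 + η * ∑ k ∈ Finset.range K, γ k)).and (eventually_ge_atTop K) |>.exists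
    have := h1 n hn.2
    nlinarith [sq_nonneg (infDist (x n) W), hn.1]
  have jump : ∀ k ≥ K, gap k ≤ η → infDist (x (k + 1)) W ≤ 2 * (c / 3) := by
    intro k hk hgap
    have h1 := hgr k hgap
    have h2 := hstep k (hK k hk).1
    linarith [(hK k hk).2.2]
  have inv : ∀ k ≥ m, infDist (x k) W ≤ 2 * (c / 3) := by
    intro k hk
    induction k, hk using Nat.le_induction with
    | base => linarith [hgr m hgm]
    | succ k hk ih =>
      by_cases hgap : gap k ≤ η
      · exact jump k (hm.trans hk) hgap
      · have h1 := decr k (hm.trans hk) (not_le.1 hgap)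
        have h2 : 0 ≤ γ k * η := mul_nonneg (hγ k) hη.le
        exact (pow_le_pow_iff_left₀ infDist_nonneg infDist_nonneg two_ne_zero).1
          (by linarith : infDist (x (k + 1)) W ^ 2 ≤ infDist (x k) W ^ 2) |>.trans ih
  filter_upwards [eventually_ge_atTop m] with k hk
  linarith [inv k hk]

end Subgradient

/-! ### Utilities -/

namespace IsUtility

variable {D : Set ℝ} {U U' : ℝ → ℝ}

theorem nonneg (h : IsUtility D U U') {x : ℝ} (hx : x ∈ D) : 0 ≤ x := by
  rcases h.dom with hD | ⟨hD, -⟩ <;> rw [hD] at hx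
  · exact hx
  · exact le_of_lt hx

theorem mem_of_pos (h : IsUtility D U U') {x : ℝ} (hx : 0 < x) : x ∈ D := by
  rcases h.dom with hD | ⟨hD, -⟩ <;> rw [hD]
  · exact hx.le
  · exact hx

theorem mem_of_le (h : IsUtility D U U') {x y : ℝ} (hx : x ∈ D) (hxy : x ≤ y) : y ∈ D := by
  rcases hxy.eq_or_lt with rfl | hlt
  · exact hx
  · exact h.mem_of_pos ((h.nonneg hx).trans_lt hlt)

/-- A utility lies below its tangents. -/
theorem tangent_lt (h : IsUtility D U U') {x y : ℝ} (hx : x ∈ D) (hy : y ∈ D) (hxy : x ≠ y) :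
    U y - U x < U' x * (y - x) := by
  rcases lt_or_gt_of_ne hxy with hlt | hlt
  · have := h.concave.slope_lt_of_hasDerivWithinAt hx hy hlt (h.deriv x hx)
    rwa [slope_def_field, div_lt_iff₀ (sub_pos.2 hlt)] at this
  · have := h.concave.lt_slope_of_hasDerivWithinAt hy hx hlt (h.deriv x hx)
    rw [slope_def_field, lt_div_iff₀ (sub_pos.2 hlt)] at this
    linarith

theorem tangent_le (h : IsUtility D U U') {x y : ℝ} (hx : x ∈ D) (hy : y ∈ D) :
    U y - U x ≤ U' x * (y - x) := by
  rcases eq_or_ne x y with rfl | hxy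
  · simp
  · exact (h.tangent_lt hx hy hxy).le

theorem deriv_lt (h : IsUtility D U U') {x y : ℝ} (hx : x ∈ D) (hxy : x < y) : U' y < U' x := by
  have hy := h.mem_of_le hx hxy.le
  have h1 := h.tangent_lt hx hy hxy.ne
  have h2 := h.tangent_lt hy hx hxy.ne'
  have h3 : U' y * (y - x) < U' x * (y - x) := by linarith
  exact lt_of_mul_lt_mul_right h3 (sub_pos.2 hxy).le

theorem deriv_le (h : IsUtility D U U') {x y : ℝ} (hx : x ∈ D) (hxy : x ≤ y) : U' y ≤ U' x := by
  rcases hxy.eq_or_lt with rfl | hlt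
  · exact le_rfl
  · exact (h.deriv_lt hx hlt).le

theorem deriv_injOn (h : IsUtility D U U') : Set.InjOn U' D := by
  intro x hx y hy hxy
  rcases lt_trichotomy x y with hlt | heq | hlt
  · exact absurd hxy (h.deriv_lt hx hlt).ne'
  · exact heq
  · exact absurd hxy (h.deriv_lt hy hlt).ne

theorem continuousOn (h : IsUtility D U U') : ContinuousOn U D :=
  fun x hx => (h.deriv x hx).continuousWithinAt

theorem tendsto_deriv_right (h : IsUtility D U U') {x : ℝ} (hx : x ∈ D) :
    Tendsto U' (𝓝[>] x) (𝓝 (U' x)) :=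
  (h.cont x hx).mono_left (nhdsWithin_mono x fun _ hy => h.mem_of_le hx (le_of_lt hy))

theorem tendsto_deriv_left (h : IsUtility D U U') {x : ℝ} (hx : 0 < x) :
    Tendsto U' (𝓝[<] x) (𝓝 (U' x)) := by
  have hD : D ∈ 𝓝 x := mem_of_superset (Ioi_mem_nhds hx) fun _ hy => h.mem_of_pos hy
  exact ((h.cont x (h.mem_of_pos hx)).continuousAt hD).mono_left nhdsWithin_le_nhds

theorem deriv_le_of_isMax (h : IsUtility D U U') {ω x : ℝ} (hx : x ∈ D)
    (hmax : ∀ y ∈ D, U y - ω * y ≤ U x - ω * x) : U' x ≤ ω := by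
  refine le_of_tendsto (h.tendsto_deriv_right hx) ?_
  filter_upwards [self_mem_nhdsWithin] with y (hy : x < y)
  have hyD := h.mem_of_le hx hy.le
  have h1 := hmax y hyD
  have h2 := h.tangent_le hyD hx
  refine le_of_mul_le_mul_right ?_ (sub_pos.2 hy)
  linarith

theorem deriv_eq_of_isMax (h : IsUtility D U U') {ω x : ℝ} (hx : 0 < x)
    (hmax : ∀ y ∈ D, U y - ω * y ≤ U x - ω * x) : U' x = ω := by
  refine le_antisymm (h.deriv_le_of_isMax (h.mem_of_pos hx) hmax) ?_
  refine ge_of_tendsto (h.tendsto_deriv_left hx) ?_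
  filter_upwards [self_mem_nhdsWithin, mem_nhdsWithin_of_mem_nhds (Ioi_mem_nhds hx)]
    with y (hy : y < x) (hy0 : 0 < y)
  have hyD := h.mem_of_pos hy0
  have h1 := hmax y hyD
  have h2 := h.tangent_le hyD (h.mem_of_pos hx)
  refine le_of_mul_le_mul_right ?_ (sub_pos.2 hy)
  linarith

/-- First-order conditions at a point suffice for it to solve the link problem. -/
theorem isMax_of_deriv (h : IsUtility D U U') {ω x : ℝ} (hx : x ∈ D) (hle : U' x ≤ ω)
    (heq : 0 < x → U' x = ω) {y : ℝ} (hy : y ∈ D) : U y - ω * y ≤ U x - ω * x := by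
  have h1 := h.tangent_le hx hy
  have h2 : U' x * (y - x) ≤ ω * (y - x) := by
    rcases (h.nonneg hx).eq_or_lt with h0 | h0
    · exact mul_le_mul_of_nonneg_right hle (by linarith [h.nonneg hy])
    · rw [heq h0]
  linarith

/-- If the point `z` is almost optimal in the link problem of price `ω`, then `ω` almost satisfies
the first-order conditions at `z`. -/
theorem price_near_of_gap_le (h : IsUtility D U U') {z : ℝ} (hz : z ∈ D) {δ : ℝ} (hδ : 0 < δ) :
    ∃ η > 0, ∀ ω x, (∀ y ∈ D, U y - ω * y ≤ U x - ω * x) →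
      (U x - ω * x) - (U z - ω * z) ≤ η → U' z - ω ≤ δ ∧ (0 < z → ω - U' z ≤ δ) := by
  -- If `ω` is too far from `U' z`, a fixed point close to `z` beats `z` by a fixed amount.
  obtain ⟨y, hyU, hzy⟩ : ∃ y, U' z - δ / 2 < U' y ∧ z < y :=
    (((h.tendsto_deriv_right hz).eventually_const_lt (by linarith)).and
      self_mem_nhdsWithin).exists
  have hy := h.mem_of_le hz hzy.le
  have hyz := h.tangent_le hy hz
  have right : ∀ ω x, (∀ y ∈ D, U y - ω * y ≤ U x - ω * x) →
      (U x - ω * x) - (U z - ω * z) ≤ (y - z) * (δ / 2) → U' z - ω ≤ δ := by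
    intro ω x hmax hgap
    by_contra! hcon
    have h1 := hmax y hy
    have h2 : (ω + δ / 2) * (y - z) < U' y * (y - z) :=
      mul_lt_mul_of_pos_right (by linarith) (sub_pos.2 hzy)
    nlinarith
  rcases (h.nonneg hz).eq_or_lt with h0 | h0
  · exact ⟨(y - z) * (δ / 2), by have := sub_pos.2 hzy; positivity,
      fun ω x hmax hgap => ⟨right ω x hmax hgap, fun hpos => absurd h0 hpos.ne⟩⟩
  obtain ⟨v, ⟨hvU, hvz⟩, hv0⟩ : ∃ v, (U' v < U' z + δ / 2 ∧ v < z) ∧ 0 < v :=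
    ((((h.tendsto_deriv_left h0).eventually_lt_const (by linarith)).and
      self_mem_nhdsWithin).and (mem_nhdsWithin_of_mem_nhds (Ioi_mem_nhds h0))).exists
  have hv := h.mem_of_pos hv0
  have hvz' := h.tangent_le hv hz
  refine ⟨min ((y - z) * (δ / 2)) ((z - v) * (δ / 2)), ?_, fun ω x hmax hgap => ⟨?_, fun _ => ?_⟩⟩
  · have := sub_pos.2 hzy
    have := sub_pos.2 hvz
    positivity
  · exact right ω x hmax (hgap.trans (min_le_left _ _))
  · by_contra! hcon
    have h1 := hmax v hv
    have h2 : U' v * (z - v) < (ω - δ / 2) * (z - v) :=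
      mul_lt_mul_of_pos_right (by linarith) (sub_pos.2 hvz)
    have h3 := hgap.trans (min_le_right _ _)
    nlinarith

end IsUtility

/-! ### Existence and uniqueness of the optimal spare capacities -/

namespace TEProblem

variable {N J R : Type*} [DecidableEq N] [Fintype R] {P : TEProblem N J R}

theorem load_combo (P : TEProblem N J R) (a b : ℝ) (f f' : N → J → ℝ) (e : J) :
    P.load (a • f + b • f') e = a * P.load f e + b * P.load f' e := by
  simp [load, Finset.sum_add_distrib, Finset.mul_sum]

theorem load_congr {f f' : N → J → ℝ} (h : ∀ t ∈ P.dests, f t = f' t) : P.load f = P.load f' := by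
  funext e
  exact Finset.sum_congr rfl fun t ht => by rw [h t ht]

theorem continuous_load (P : TEProblem N J R) (e : J) : Continuous fun f => P.load f e :=
  continuous_finsetSum _ fun t _ => (continuous_apply e).comp (continuous_apply t)

variable [Fintype J]

theorem IsRouting.combo {t : N} {g h : J → ℝ} {a b : ℝ} (hg : P.IsRouting t g)
    (hh : P.IsRouting t h) (hab : a + b = 1) (hnn : ∀ e, 0 ≤ a * g e + b * h e) :
    P.IsRouting t (a • g + b • h) := by
  refine ⟨hnn, ?_⟩
  rw [Matrix.mulVec_add, Matrix.mulVec_smul, Matrix.mulVec_smul, hg.2, hh.2, ← add_smul, hab,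
    one_smul]

theorem Feasible.load_nonneg {s : J → ℝ} {f : N → J → ℝ} (h : P.Feasible s f) (e : J) :
    0 ≤ P.load f e :=
  Finset.sum_nonneg fun t ht => (h.routing t ht).1 e

theorem Feasible.spare_le_cap {s : J → ℝ} {f : N → J → ℝ} (h : P.Feasible s f) (e : J) :
    s e ≤ P.cap e := by
  linarith [h.load_nonneg e, h.spare e]

theorem Feasible.combo (hU : ∀ e, IsUtility (P.dom e) (P.V e) (P.V' e)) {s s' : J → ℝ}
    {f f' : N → J → ℝ} (h : P.Feasible s f) (h' : P.Feasible s' f') {a b : ℝ} (ha : 0 ≤ a)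
    (hb : 0 ≤ b) (hab : a + b = 1) : P.Feasible (a • s + b • s') (a • f + b • f') where
  routing t ht := (h.routing t ht).combo (h'.routing t ht) hab fun e =>
    add_nonneg (mul_nonneg ha ((h.routing t ht).1 e)) (mul_nonneg hb ((h'.routing t ht).1 e))
  spare e := by
    rw [load_combo, Pi.add_apply, Pi.smul_apply, Pi.smul_apply, ← h.spare, ← h'.spare]
    simp only [smul_eq_mul]
    linear_combination (-P.cap e) * hab
  mem_dom e := (hU e).concave.1 (h.mem_dom e) (h'.mem_dom e) ha hb hab

/-- The objective of TE is strictly concave in the spare capacities. -/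
theorem IsOptimal.spare_unique (hU : ∀ e, IsUtility (P.dom e) (P.V e) (P.V' e)) {s s' : J → ℝ}
    {f f' : N → J → ℝ} (h : P.IsOptimal s f) (h' : P.IsOptimal s' f') : s = s' := by
  by_contra hne
  obtain ⟨e₀, he₀⟩ := Function.ne_iff.1 hne
  have h1 := h.2 _ _ (h.1.combo hU h'.1 (a := 1 / 2) (b := 1 / 2)
    (by norm_num) (by norm_num) (by norm_num))
  have h2 := h'.2 _ _ h.1
  have h3 : ∑ e, (1 / 2 * P.V e (s e) + 1 / 2 * P.V e (s' e)) <
      ∑ e, P.V e (((1 / 2 : ℝ) • s + (1 / 2 : ℝ) • s') e) := by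
    refine Finset.sum_lt_sum (fun e _ => ?_) ⟨e₀, Finset.mem_univ _, ?_⟩
    · exact (hU e).concave.concaveOn.2 (h.1.mem_dom e) (h'.1.mem_dom e) (by norm_num)
        (by norm_num) (by norm_num)
    · exact (hU e₀).concave.2 (h.1.mem_dom e₀) (h'.1.mem_dom e₀) he₀ (by norm_num)
        (by norm_num) (by norm_num)
  rw [Finset.sum_add_distrib, ← Finset.mul_sum, ← Finset.mul_sum] at h3
  linarith

/-- The families of routings that leave at least the spare capacity `ℓ e` on each link `e`, with
the irrelevant flows to vertices that are not destinations set to zero. -/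
def routingsAbove (P : TEProblem N J R) (ℓ : J → ℝ) : Set (N → J → ℝ) :=
  {f | (∀ t ∈ P.dests, P.IsRouting t (f t)) ∧ (∀ t ∉ P.dests, f t = 0) ∧
    ∀ e, ℓ e ≤ P.cap e - P.load f e}

theorem isClosed_isRouting (P : TEProblem N J R) (t : N) : IsClosed {g | P.IsRouting t g} := by
  have h1 : IsClosed {g : J → ℝ | ∀ e, 0 ≤ g e} := by
    simp only [Set.ofPred_forall]
    exact isClosed_iInter fun e => isClosed_le continuous_const (continuous_apply e)
  have h2 : IsClosed {g : J → ℝ | P.incidence.mulVec g = P.supply t} :=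
    isClosed_eq (Continuous.matrix_mulVec continuous_const continuous_id) continuous_const
  exact h1.inter h2

theorem isCompact_routingsAbove (P : TEProblem N J R) {ℓ : J → ℝ} (hℓ : ∀ e, 0 ≤ ℓ e) :
    IsCompact (P.routingsAbove ℓ) := by
  have hbox : IsCompact (Set.univ.pi fun _ : N => Set.univ.pi fun e : J =>
      Set.Icc (0 : ℝ) |P.cap e|) :=
    isCompact_univ_pi fun _ => isCompact_univ_pi fun _ => isCompact_Icc
  refine hbox.of_isClosed_subset ?_ ?_
  · have h1 : IsClosed {f : N → J → ℝ | ∀ t ∈ P.dests, P.IsRouting t (f t)} := by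
      simp only [Set.ofPred_forall]
      exact isClosed_iInter fun t => isClosed_iInter fun _ =>
        IsClosed.preimage (f := fun f : N → J → ℝ => f t) (continuous_apply t)
          (P.isClosed_isRouting t)
    have h2 : IsClosed {f : N → J → ℝ | ∀ t ∉ P.dests, f t = 0} := by
      simp only [Set.ofPred_forall]
      exact isClosed_iInter fun t => isClosed_iInter fun _ =>
        isClosed_eq (continuous_apply t) continuous_const
    have h3 : IsClosed {f : N → J → ℝ | ∀ e, ℓ e ≤ P.cap e - P.load f e} := by
      simp only [Set.ofPred_forall]
      exact isClosed_iInter fun e =>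
        isClosed_le continuous_const (continuous_const.sub (P.continuous_load e))
    exact h1.inter (h2.inter h3)
  · intro f hf t _ e _
    have hle : P.load f e ≤ P.cap e := by linarith [hf.2.2 e, hℓ e]
    by_cases ht : t ∈ P.dests
    · refine ⟨(hf.1 t ht).1 e, le_trans ?_ (hle.trans (le_abs_self _))⟩
      exact Finset.single_le_sum (f := fun t => f t e) (fun t ht => (hf.1 t ht).1 e) ht
    · rw [hf.2.1 t ht]
      exact ⟨le_rfl, abs_nonneg _⟩

/-- TE has an optimal solution: at links with a singular utility the spare capacity can be kept
away from zero, since close to zero its marginal utility outweighs all the other links. -/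
theorem exists_isOptimal (hU : ∀ e, IsUtility (P.dom e) (P.V e) (P.V' e))
    (hfeas : ∃ s f, P.Feasible s f) : ∃ s f, P.IsOptimal s f := by
  classical
  have prune : ∀ s f, P.Feasible s f → ∃ f', P.Feasible s f' ∧ ∀ t ∉ P.dests, f' t = 0 := by
    intro s f h
    have heq : ∀ t ∈ P.dests, (if t ∈ P.dests then f t else 0) = f t := fun t ht => if_pos ht
    refine ⟨fun t => if t ∈ P.dests then f t else 0, ⟨fun t ht => ?_, fun e => ?_, h.mem_dom⟩,
      fun t ht => if_neg ht⟩
    · simp only [if_pos ht]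
      exact h.routing t ht
    · rw [load_congr heq]
      exact h.spare e
  obtain ⟨u, f₀, h₀⟩ := hfeas
  obtain ⟨f₀, h₀, hz₀⟩ := prune u f₀ h₀
  set B : ℝ := ∑ e, P.V' e (u e) * P.cap e with hB
  have hcap : ∀ e, 0 ≤ P.cap e := fun e =>
    ((hU e).nonneg (h₀.mem_dom e)).trans (h₀.spare_le_cap e)
  have hterm : ∀ e, 0 ≤ P.V' e (u e) * P.cap e := fun e =>
    mul_nonneg ((hU e).pos _ (h₀.mem_dom e)).le (hcap e)
  have hτ : ∀ e, ∃ τ > 0, P.dom e ≠ Set.Ici 0 →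
      τ ≤ u e / 2 ∧ ∀ x, 0 < x → x < τ → B < P.V' e x * (u e / 2) := by
    intro e
    rcases (hU e).dom with hD | ⟨hD, htop⟩
    · exact ⟨1, one_pos, fun h => absurd hD h⟩
    · have hu : 0 < u e := by have := h₀.mem_dom e; rwa [hD] at this
      have h1 : ∀ᶠ x in 𝓝[>] (0 : ℝ), B < P.V' e x * (u e / 2) :=
        (htop.atTop_mul_const (by positivity)).eventually_gt_atTop B
      obtain ⟨τ, hτ0, hτ⟩ := mem_nhdsGT_iff_exists_Ioo_subset.1 h1
      refine ⟨min τ (u e / 2), lt_min hτ0 (by positivity), fun _ => ⟨min_le_right _ _, ?_⟩⟩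
      exact fun x hx hxτ => hτ ⟨hx, hxτ.trans_le (min_le_left _ _)⟩
  choose τ hτ0 hτ using hτ
  obtain ⟨σ, hσ, hστ⟩ := exists_pos_forall_le τ hτ0
  set ℓ : J → ℝ := fun e => if P.dom e = Set.Ici 0 then 0 else σ / 2 with hℓ
  have hℓ0 : ∀ e, 0 ≤ ℓ e := by
    intro e; simp only [hℓ]; split_ifs <;> positivity
  have hdom : ∀ e x, ℓ e ≤ x → x ∈ P.dom e := by
    intro e x hx
    simp only [hℓ] at hx
    split_ifs at hx with hD
    · rw [hD]; exact hx
    · exact (hU e).mem_of_pos (lt_of_lt_of_le (by positivity) hx)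
  have feas : ∀ f ∈ P.routingsAbove ℓ, P.Feasible (fun e => P.cap e - P.load f e) f :=
    fun f hf => ⟨hf.1, fun e => rfl, fun e => hdom e _ (hf.2.2 e)⟩
  have mem : ∀ s f, P.Feasible s f → (∀ t ∉ P.dests, f t = 0) → (∀ e, ℓ e ≤ s e) →
      f ∈ P.routingsAbove ℓ :=
    fun s f h hz hs => ⟨h.routing, hz, fun e => (hs e).trans (h.spare e).ge⟩
  have hlow : ∀ s f, P.Feasible s f → ∀ e, (P.dom e ≠ Set.Ici 0 → σ / 2 ≤ s e) → ℓ e ≤ s e := by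
    intro s f h e hs
    simp only [hℓ]
    split_ifs with hD
    · exact (hU e).nonneg (h.mem_dom e)
    · exact hs hD
  have hne : (P.routingsAbove ℓ).Nonempty := ⟨f₀, mem u f₀ h₀ hz₀ fun e =>
    hlow u f₀ h₀ e fun hD => by
    linarith [(hτ e hD).1, hστ e, (hU e).nonneg (h₀.mem_dom e)]⟩
  obtain ⟨f, hf, hmax⟩ := (P.isCompact_routingsAbove hℓ0).exists_isMaxOn hne
    (f := fun f => ∑ e, P.V e (P.cap e - P.load f e)) (by
      refine continuousOn_finsetSum _ fun e _ => ?_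
      exact (hU e).continuousOn.comp
        (continuous_const.sub (P.continuous_load e)).continuousOn
        fun f hf => hdom e _ (hf.2.2 e))
  have hfF := feas f hf
  set s : J → ℝ := fun e => P.cap e - P.load f e with hs
  have hmax' : ∀ s' f', P.Feasible s' f' → (∀ t ∉ P.dests, f' t = 0) → (∀ e, ℓ e ≤ s' e) →
      ∑ e, P.V e (s' e) ≤ ∑ e, P.V e (s e) := by
    intro s' f' h' hz hl
    have h1 := hmax (mem s' f' h' hz hl)
    simp only [h'.spare, Set.mem_ofPred_eq] at h1
    exact h1
  -- Moving towards `u` improves `s` if a singular link has less than `σ` left.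
  have hsσ : ∀ e, P.dom e ≠ Set.Ici 0 → σ ≤ s e := by
    intro e₀ hD
    by_contra! hlt
    obtain ⟨hu1, hbig⟩ := hτ e₀ hD
    have hs0 : 0 < s e₀ := by
      have := hf.2.2 e₀
      simp only [hℓ, if_neg hD] at this
      exact lt_of_lt_of_le (by positivity) this
    have hu0 : 0 < u e₀ := by linarith [hτ0 e₀]
    obtain ⟨θ, ⟨hθ1, hθs⟩, hθ0 : 0 < θ⟩ : ∃ θ : ℝ,
        (θ < 1 ∧ (1 - θ) * s e₀ + θ * u e₀ < σ) ∧ θ ∈ Set.Ioi (0 : ℝ) := by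
      have hc : Tendsto (fun θ : ℝ => (1 - θ) * s e₀ + θ * u e₀) (𝓝[>] 0) (𝓝 (s e₀)) := by
        have : Continuous fun θ : ℝ => (1 - θ) * s e₀ + θ * u e₀ := by fun_prop
        have := this.tendsto 0
        simp only [sub_zero, one_mul, zero_mul, add_zero] at this
        exact this.mono_left nhdsWithin_le_nhds
      exact ((((tendsto_nhdsWithin_of_tendsto_nhds tendsto_id).eventually_lt_const one_pos).and
        (hc.eventually_lt_const hlt)).and self_mem_nhdsWithin).exists
    have hz := hfF.combo hU h₀ (a := 1 - θ) (b := θ) (by linarith) hθ0.le (by ring)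
    set z := (1 - θ) • s + θ • u with hzdef
    have hze : ∀ e, z e = (1 - θ) * s e + θ * u e := fun e => rfl
    have h1 : ∑ e, P.V e (z e) ≤ ∑ e, P.V e (s e) := by
      refine hmax' _ _ hz (fun t ht => ?_) fun e => ?_
      · rw [Pi.add_apply, Pi.smul_apply, Pi.smul_apply, hf.2.1 t ht, hz₀ t ht, smul_zero,
          smul_zero, add_zero]
      · have h2 := hf.2.2 e
        have h3 : ℓ e ≤ u e := hlow u f₀ h₀ e fun hD => by
          linarith [(hτ e hD).1, hστ e, (hU e).nonneg (h₀.mem_dom e)]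
        rw [hze]
        nlinarith
    have h2 : ∀ e, θ * (P.V' e (z e) * (u e - s e)) ≤ P.V e (z e) - P.V e (s e) := by
      intro e
      have := (hU e).tangent_le (hz.mem_dom e) (hfF.mem_dom e)
      have h3 : P.V' e (z e) * (s e - z e) = -(θ * (P.V' e (z e) * (u e - s e))) := by
        rw [hze]; ring
      linarith
    have h3 : ∀ e, -(P.V' e (u e) * P.cap e) ≤ P.V' e (z e) * (u e - s e) := by
      intro e
      have hzpos := (hU e).pos _ (hz.mem_dom e)
      rcases le_total (s e) (u e) with hle | hle
      · have := mul_nonneg hzpos.le (sub_nonneg.2 hle)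
        linarith [hterm e]
      · have hzu : u e ≤ z e := by rw [hze]; nlinarith
        have h4 := (hU e).deriv_le (h₀.mem_dom e) hzu
        have h5 := hfF.spare_le_cap e
        have h6 := (hU e).nonneg (h₀.mem_dom e)
        nlinarith
    have h4 : B < P.V' e₀ (z e₀) * (u e₀ - s e₀) := by
      have hz0 : 0 < z e₀ := by rw [hze]; have := sub_pos.2 hθ1; positivity
      have h5 := hbig (z e₀) hz0 (by rw [hze]; exact hθs.trans_le (hστ e₀))
      have h6 := (hU e₀).pos _ (hz.mem_dom e₀)
      have h7 : u e₀ / 2 ≤ u e₀ - s e₀ := by linarith [hστ e₀]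
      exact h5.trans_le (mul_le_mul_of_nonneg_left h7 h6.le)
    have h5 : 0 < ∑ e, P.V' e (z e) * (u e - s e) := by
      have h6 := Finset.sum_erase_add Finset.univ (fun e => P.V' e (z e) * (u e - s e))
        (Finset.mem_univ e₀)
      have h7 : -B ≤ ∑ e ∈ Finset.univ.erase e₀, P.V' e (z e) * (u e - s e) := by
        calc -B ≤ -∑ e ∈ Finset.univ.erase e₀, P.V' e (u e) * P.cap e :=
              neg_le_neg (Finset.sum_le_sum_of_subset_of_nonneg (Finset.erase_subset _ _)
                fun e _ _ => hterm e)
          _ ≤ _ := by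
              rw [← Finset.sum_neg_distrib]
              exact Finset.sum_le_sum fun e _ => h3 e
      linarith
    have h6 : θ * ∑ e, P.V' e (z e) * (u e - s e) ≤ ∑ e, P.V e (z e) - ∑ e, P.V e (s e) := by
      rw [Finset.mul_sum, ← Finset.sum_sub_distrib]
      exact Finset.sum_le_sum fun e _ => h2 e
    have := mul_pos hθ0 h5
    linarith
  refine ⟨s, f, hfF, fun s' f' h' => ?_⟩
  by_contra! hlt
  obtain ⟨f', h', hz'⟩ := prune s' f' h'
  have hmid := hfF.combo hU h' (a := 1 / 2) (b := 1 / 2) (by norm_num) (by norm_num) (by norm_num)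
  have h1 := hmax' _ _ hmid (fun t ht => by
    rw [Pi.add_apply, Pi.smul_apply, Pi.smul_apply, hf.2.1 t ht, hz' t ht, smul_zero, add_zero])
    fun e => hlow _ _ hmid e fun hD => by
      have h2 := hsσ e hD
      have h3 := (hU e).nonneg (h'.mem_dom e)
      simp only [Pi.add_apply, Pi.smul_apply, smul_eq_mul]
      linarith
  have h2 : ∑ e, (1 / 2 * P.V e (s e) + 1 / 2 * P.V e (s' e)) ≤
      ∑ e, P.V e (((1 / 2 : ℝ) • s + (1 / 2 : ℝ) • s') e) :=
    Finset.sum_le_sum fun e _ => (hU e).concave.concaveOn.2 (hfF.mem_dom e) (h'.mem_dom e)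
      (by norm_num) (by norm_num) (by norm_num)
  rw [Finset.sum_add_distrib, ← Finset.mul_sum, ← Finset.mul_sum] at h2
  linarith

end TEProblem

/-! ### Lagrange multipliers -/

namespace TEProblem

variable {N J R : Type*} [DecidableEq N] {P : TEProblem N J R}

theorem sum_mul_incidence [Fintype N] (P : TEProblem N J R) (ν : N → ℝ) (e : J) :
    ∑ i, ν i * P.incidence i e = ν (P.src e) - ν (P.dst e) := by
  simp [incidence, mul_sub, Finset.sum_sub_distrib]

theorem sum_mul_mulVec_incidence [Fintype N] [Fintype J] (P : TEProblem N J R) (ν : N → ℝ)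
    (g : J → ℝ) :
    ∑ i, ν i * P.incidence.mulVec g i = ∑ e, (ν (P.src e) - ν (P.dst e)) * g e := by
  simp only [Matrix.mulVec, dotProduct, Finset.mul_sum, ← sum_mul_incidence, Finset.sum_mul]
  rw [Finset.sum_comm]
  exact Finset.sum_congr rfl fun e _ => Finset.sum_congr rfl fun i _ => by ring

variable [Fintype R] [Fintype J]

theorem sum_mul_load (P : TEProblem N J R) (w : J → ℝ) (f : N → J → ℝ) :
    ∑ e, w e * P.load f e = ∑ t ∈ P.dests, ∑ e, w e * f t e := by
  simp only [load, Finset.mul_sum]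
  exact Finset.sum_comm

/-- A circulation whose negative entries are on links that carry flow is a feasible direction, so
it has nonnegative cost. -/
theorem SolvesRoute.cost_nonneg {t : N} {w g x : J → ℝ} (h : P.SolvesRoute t w g)
    (hx : P.incidence.mulVec x = 0) (hnn : ∀ e, g e = 0 → 0 ≤ x e) : 0 ≤ ∑ e, w e * x e := by
  have h1 : ∀ e, ∀ᶠ r in 𝓝[>] (0 : ℝ), 0 ≤ g e + r * x e := by
    intro e
    rcases (h.1.1 e).eq_or_lt with h0 | h0
    · filter_upwards [self_mem_nhdsWithin] with r hr
      rw [← h0, zero_add]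
      exact mul_nonneg (le_of_lt hr) (hnn e h0.symm)
    · have hc : Tendsto (fun r : ℝ => g e + r * x e) (𝓝[>] 0) (𝓝 (g e)) := by
        have : Continuous fun r : ℝ => g e + r * x e := by fun_prop
        have := this.tendsto 0
        simp only [zero_mul, add_zero] at this
        exact this.mono_left nhdsWithin_le_nhds
      exact (hc.eventually_const_lt h0).mono fun r hr => hr.le
  obtain ⟨r, hr, hr0 : 0 < r⟩ := ((eventually_all.2 h1).and self_mem_nhdsWithin).exists
  have h2 := h.2 (g + r • x) ⟨hr, by
    rw [Matrix.mulVec_add, Matrix.mulVec_smul, hx, smul_zero, add_zero, h.1.2]⟩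
  have h3 : ∑ e, w e * (g + r • x) e = ∑ e, w e * g e + r * ∑ e, w e * x e := by
    rw [Finset.mul_sum, ← Finset.sum_add_distrib]
    exact Finset.sum_congr rfl fun e _ => by
      rw [Pi.add_apply, Pi.smul_apply, smul_eq_mul]; ring
  exact nonneg_of_mul_nonneg_right (by linarith) hr0

/-- Linear programming duality for the routing problem. -/
theorem SolvesRoute.exists_potential [Fintype N] {t : N} {w g : J → ℝ} (h : P.SolvesRoute t w g) :
    ∃ ν : N → ℝ, (∀ e, 0 < g e → ν (P.dst e) - ν (P.src e) - w e = 0) ∧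
      ∀ e, ν (P.dst e) - ν (P.src e) - w e ≤ 0 := by
  classical
  obtain ⟨c, ν, hc, hb⟩ := farkas_of_equations
    (fun e => if g e = 0 then -LinearMap.proj e else 0 : J → (J → ℝ) →ₗ[ℝ] ℝ)
    (fun i => (LinearMap.proj i).comp P.incidence.mulVecLin : N → (J → ℝ) →ₗ[ℝ] ℝ)
    (-∑ e, w e • LinearMap.proj e) (by
      intro x ha hL
      have := h.cost_nonneg (x := x) (funext fun i => hL i) fun e he => by
        have := ha e
        simp only [he, if_true, LinearMap.neg_apply, LinearMap.proj_apply] at this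
        linarith
      simpa using this)
  have key : ∀ e, ν (P.dst e) - ν (P.src e) - w e = -if g e = 0 then c e else 0 := by
    intro e
    have h1 := hb (Pi.single e 1)
    have h2 := P.sum_mul_mulVec_incidence ν (Pi.single e 1)
    have h3 : ∑ i, c i * (if g i = 0 then -LinearMap.proj i else 0 : (J → ℝ) →ₗ[ℝ] ℝ)
        (Pi.single e 1) = -if g e = 0 then c e else 0 := by
      rw [Finset.sum_eq_single e]
      · split_ifs <;> simp
      · intro i _ hi
        split_ifs <;> simp [hi]
      · simp
    rw [h3] at h1
    simp only [LinearMap.coe_comp, Function.comp_apply, LinearMap.proj_apply,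
      Matrix.mulVecLin_apply] at h1
    rw [h2] at h1
    simp only [LinearMap.neg_apply, LinearMap.sum_apply, LinearMap.smul_apply, LinearMap.proj_apply,
      smul_eq_mul, Pi.single_apply, mul_ite, mul_one, mul_zero, Finset.sum_ite_eq',
      Finset.mem_univ, if_true] at h1
    linarith
  refine ⟨ν, fun e he => ?_, fun e => ?_⟩
  · rw [key, if_neg he.ne', neg_zero]
  · rw [key]
    split_ifs
    · exact neg_nonpos.2 (hc e)
    · simp

/-- `w` is a dual optimal solution of TE that certifies the optimality of `(s, f)`: the prices `w`
satisfy the first-order conditions of the link problems at `s`, and the flows `f t` are cheapest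
routings. Unlike in `IsFirstWeights`, no node potentials are involved. -/
structure IsEquilibrium (P : TEProblem N J R) (s : J → ℝ) (f : N → J → ℝ) (w : J → ℝ) : Prop where
  deriv_le : ∀ e, P.V' e (s e) ≤ w e
  deriv_eq : ∀ e, 0 < s e → P.V' e (s e) = w e
  route : ∀ t ∈ P.dests, P.SolvesRoute t w (f t)

theorem IsEquilibrium.isFirstWeights [Fintype N] {s w : J → ℝ} {f : N → J → ℝ}
    (hf : P.Feasible s f) (h : P.IsEquilibrium s f w) : P.IsFirstWeights w := by
  have : ∀ t, ∃ ν : N → ℝ, t ∈ P.dests →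
      (∀ e, 0 < f t e → ν (P.dst e) - ν (P.src e) - w e = 0) ∧
        ∀ e, ν (P.dst e) - ν (P.src e) - w e ≤ 0 := by
    intro t
    by_cases ht : t ∈ P.dests
    · obtain ⟨ν, hν⟩ := (h.route t ht).exists_potential
      exact ⟨ν, fun _ => hν⟩
    · exact ⟨0, fun h => absurd h ht⟩
  choose ν hν using this
  exact ⟨s, f, ν, hf, fun e he => sub_eq_zero.2 (h.deriv_eq e he),
    fun e _ => sub_nonpos.2 (h.deriv_le e), fun t ht => (hν t ht).1,
    fun t ht e _ => (hν t ht).2 e⟩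

theorem IsFirstWeights.exists_isEquilibrium [Fintype N]
    (hU : ∀ e, IsUtility (P.dom e) (P.V e) (P.V' e)) {w : J → ℝ} (h : P.IsFirstWeights w) :
    ∃ s f, P.Feasible s f ∧ P.IsEquilibrium s f w := by
  obtain ⟨s, f, ν, hf, h1, h2, h3, h4⟩ := h
  refine ⟨s, f, hf, fun e => ?_, fun e he => sub_eq_zero.1 (h1 e he), fun t ht => ?_⟩
  · rcases ((hU e).nonneg (hf.mem_dom e)).eq_or_lt with h0 | h0
    · exact sub_nonpos.1 (h2 e h0.symm)
    · exact (sub_eq_zero.1 (h1 e h0)).le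
  · have hr := hf.routing t ht
    refine ⟨hr, fun g hg => ?_⟩
    -- The reduced costs are nonnegative and vanish where `f t` is positive.
    have h5 : ∀ e, (w e + (ν t (P.src e) - ν t (P.dst e))) * f t e ≤
        (w e + (ν t (P.src e) - ν t (P.dst e))) * g e := by
      intro e
      rcases (hr.1 e).eq_or_lt with h0 | h0
      · rw [← h0, mul_zero]
        exact mul_nonneg (by linarith [h4 t ht e h0.symm]) (hg.1 e)
      · have : w e + (ν t (P.src e) - ν t (P.dst e)) = 0 := by linarith [h3 t ht e h0]
        rw [this, zero_mul, zero_mul]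
    have h6 := Finset.sum_le_sum fun e (_ : e ∈ Finset.univ) => h5 e
    simp only [add_mul, Finset.sum_add_distrib, ← sum_mul_mulVec_incidence, hr.2, hg.2] at h6
    linarith

theorem IsEquilibrium.isOptimal (hU : ∀ e, IsUtility (P.dom e) (P.V e) (P.V' e))
    {s w : J → ℝ} {f : N → J → ℝ} (hf : P.Feasible s f) (h : P.IsEquilibrium s f w) :
    P.IsOptimal s f := by
  refine ⟨hf, fun s' f' hf' => ?_⟩
  have h1 : ∀ e, P.V e (s' e) - w e * s' e ≤ P.V e (s e) - w e * s e := fun e =>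
    (hU e).isMax_of_deriv (hf.mem_dom e) (h.deriv_le e) (h.deriv_eq e) (hf'.mem_dom e)
  have h2 : ∑ e, w e * P.load f e ≤ ∑ e, w e * P.load f' e := by
    rw [sum_mul_load, sum_mul_load]
    exact Finset.sum_le_sum fun t ht => (h.route t ht).2 _ (hf'.routing t ht)
  have h3 : ∀ e, P.V e (s' e) + w e * P.load f' e ≤ P.V e (s e) + w e * P.load f e := by
    intro e
    have h4 := h1 e
    rw [← hf.spare, ← hf'.spare] at h4 ⊢
    linarith
  have h5 := Finset.sum_le_sum fun e (_ : e ∈ Finset.univ) => h3 e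
  rw [Finset.sum_add_distrib, Finset.sum_add_distrib] at h5
  linarith

/-- First-order optimality condition of TE in the directions `x` that preserve feasibility. -/
theorem IsOptimal.deriv_nonneg (hU : ∀ e, IsUtility (P.dom e) (P.V e) (P.V' e))
    {s : J → ℝ} {f x : N → J → ℝ} (h : P.IsOptimal s f) (hx : ∀ t, P.incidence.mulVec (x t) = 0)
    (hnn : ∀ t e, f t e = 0 → 0 ≤ x t e) (hs : ∀ e, s e = 0 → P.load x e ≤ 0) :
    0 ≤ ∑ e, P.V' e (s e) * P.load x e := by
  have tend : ∀ u v : ℝ, Tendsto (fun r : ℝ => u + r * v) (𝓝[>] 0) (𝓝 u) := by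
    intro u v
    have : Continuous fun r : ℝ => u + r * v := by fun_prop
    have := this.tendsto 0
    simp only [zero_mul, add_zero] at this
    exact this.mono_left nhdsWithin_le_nhds
  have hf : ∀ t ∈ P.dests, ∀ e, ∀ᶠ r in 𝓝[>] (0 : ℝ), 0 ≤ f t e + r * x t e := by
    intro t ht e
    rcases ((h.1.routing t ht).1 e).eq_or_lt with h0 | h0
    · filter_upwards [self_mem_nhdsWithin] with r hr
      rw [← h0, zero_add]
      exact mul_nonneg (le_of_lt hr) (hnn t e h0.symm)
    · exact ((tend _ _).eventually_const_lt h0).mono fun r hr => hr.le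
  have hdom : ∀ e, ∀ᶠ r in 𝓝[>] (0 : ℝ), s e + r * -P.load x e ∈ P.dom e := by
    intro e
    rcases ((hU e).nonneg (h.1.mem_dom e)).eq_or_lt with h0 | h0
    · filter_upwards [self_mem_nhdsWithin] with r hr
      refine (hU e).mem_of_le (h.1.mem_dom e) ?_
      have := mul_nonneg (le_of_lt hr) (neg_nonneg.2 (hs e h0.symm))
      linarith
    · exact ((tend _ _).eventually_const_lt h0).mono fun r hr => (hU e).mem_of_pos hr
  have hlim : Tendsto (fun r : ℝ => ∑ e, P.V' e (s e + r * -P.load x e) * P.load x e) (𝓝[>] 0)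
      (𝓝 (∑ e, P.V' e (s e) * P.load x e)) := by
    refine tendsto_finsetSum _ fun e _ => Tendsto.mul_const _ ?_
    exact ((hU e).cont (s e) (h.1.mem_dom e)).tendsto.comp
      (tendsto_nhdsWithin_iff.2 ⟨tend _ _, hdom e⟩)
  refine ge_of_tendsto hlim ?_
  have hf' : ∀ᶠ r in 𝓝[>] (0 : ℝ), ∀ t ∈ P.dests, ∀ e, 0 ≤ f t e + r * x t e :=
    (Finset.eventually_all _).2 fun t ht => eventually_all.2 (hf t ht)
  filter_upwards [hf', eventually_all.2 hdom, self_mem_nhdsWithin] with r h1 h2 (h3 : 0 < r)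
  have hfeas : P.Feasible (fun e => s e + r * -P.load x e) (f + r • x) := by
    refine ⟨fun t ht => ⟨h1 t ht, ?_⟩, fun e => ?_, h2⟩
    · rw [Pi.add_apply, Pi.smul_apply, Matrix.mulVec_add, Matrix.mulVec_smul, hx, smul_zero,
        add_zero, (h.1.routing t ht).2]
    · have := P.load_combo 1 r f x e
      rw [one_smul] at this
      rw [this, ← h.1.spare]
      ring
  have h4 := h.2 _ _ hfeas
  have h5 : ∀ e, P.V e (s e) - P.V e (s e + r * -P.load x e) ≤
      r * (P.V' e (s e + r * -P.load x e) * P.load x e) := by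
    intro e
    refine ((hU e).tangent_le (h2 e) (h.1.mem_dom e)).trans (le_of_eq ?_)
    ring
  have h6 := Finset.sum_le_sum fun e (_ : e ∈ Finset.univ) => h5 e
  rw [Finset.sum_sub_distrib, ← Finset.mul_sum] at h6
  exact nonneg_of_mul_nonneg_right (by linarith) h3

/-- Lagrange multipliers of TE exist, because its constraints are linear. -/
theorem IsOptimal.exists_isEquilibrium [Fintype N]
    (hU : ∀ e, IsUtility (P.dom e) (P.V e) (P.V' e)) {s : J → ℝ} {f : N → J → ℝ}
    (h : P.IsOptimal s f) : ∃ w, P.IsEquilibrium s f w := by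
  classical
  let pr : N → J → (N → J → ℝ) →ₗ[ℝ] ℝ := fun t e =>
    (LinearMap.proj e : (J → ℝ) →ₗ[ℝ] ℝ).comp (LinearMap.proj t)
  have hload : ∀ e x, (∑ t ∈ P.dests, pr t e) x = P.load x e := fun e x => by
    simp [pr, load]
  obtain ⟨c, ν, hc, hb⟩ := farkas_of_equations
    (Sum.elim (fun p => if f p.1 p.2 = 0 then -pr p.1 p.2 else 0)
      (fun e => if s e = 0 then ∑ t ∈ P.dests, pr t e else 0) :
        (N × J) ⊕ J → (N → J → ℝ) →ₗ[ℝ] ℝ)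
    (fun p => (LinearMap.proj p.2).comp (P.incidence.mulVecLin.comp (LinearMap.proj p.1)) :
      N × N → (N → J → ℝ) →ₗ[ℝ] ℝ)
    (-∑ e, P.V' e (s e) • ∑ t ∈ P.dests, pr t e) (by
      intro x ha hL
      have := h.deriv_nonneg hU (x := x) (fun t => funext fun i => hL (t, i))
        (fun t e he => by
          have := ha (Sum.inl (t, e))
          simp only [Sum.elim_inl, he, if_true, LinearMap.neg_apply] at this
          exact neg_nonpos.1 this)
        (fun e he => by
          have := ha (Sum.inr e)
          simp only [Sum.elim_inr, he, if_true] at this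
          rwa [hload] at this)
      rw [LinearMap.neg_apply, LinearMap.sum_apply]
      simp only [LinearMap.smul_apply, hload, smul_eq_mul]
      linarith)
  refine ⟨fun e => P.V' e (s e) + if s e = 0 then c (Sum.inr e) else 0, fun e => ?_,
    fun e he => ?_, fun t ht => ⟨h.1.routing t ht, fun g hg => ?_⟩⟩
  · split_ifs
    · exact le_add_of_nonneg_right (hc _)
    · simp
  · simp [he.ne']
  · have h1 := hb (Pi.single t (g - f t))
    have hld : ∀ e, P.load (Pi.single t (g - f t)) e = g e - f t e := by
      intro e
      rw [load, Finset.sum_eq_single_of_mem t ht]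
      · simp
      · intro t' _ hne
        simp [hne]
    have h2 : ∑ p : N × N, ν p * ((LinearMap.proj p.2).comp (P.incidence.mulVecLin.comp
        (LinearMap.proj p.1)) : (N → J → ℝ) →ₗ[ℝ] ℝ) (Pi.single t (g - f t)) = 0 := by
      refine Finset.sum_eq_zero fun p _ => ?_
      simp only [LinearMap.coe_comp, Function.comp_apply, LinearMap.proj_apply,
        Matrix.mulVecLin_apply]
      by_cases hp : p.1 = t
      · rw [hp, Pi.single_eq_same, Matrix.mulVec_sub, hg.2, (h.1.routing t ht).2, sub_self]
        simp
      · rw [Pi.single_eq_of_ne hp, Matrix.mulVec_zero]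
        simp
    have h3 : ∑ p : N × J, c (Sum.inl p) *
        (if f p.1 p.2 = 0 then -pr p.1 p.2 else 0) (Pi.single t (g - f t)) ≤ 0 := by
      refine Finset.sum_nonpos fun p _ => mul_nonpos_of_nonneg_of_nonpos (hc _) ?_
      split_ifs with hp
      · rw [LinearMap.neg_apply, neg_nonpos]
        change 0 ≤ (Pi.single t (g - f t) : N → J → ℝ) p.1 p.2
        by_cases hpt : p.1 = t
        · rw [hpt] at hp ⊢
          rw [Pi.single_eq_same, Pi.sub_apply, hp, sub_zero]
          exact hg.1 _
        · rw [Pi.single_eq_of_ne hpt]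
          simp
      · simp
    rw [h2, add_zero, Fintype.sum_sum_type] at h1
    simp only [Sum.elim_inl, Sum.elim_inr] at h1
    have h4 : ∀ e, c (Sum.inr e) * (if s e = 0 then ∑ t ∈ P.dests, pr t e else 0)
        (Pi.single t (g - f t)) = (if s e = 0 then c (Sum.inr e) else 0) * (g e - f t e) := by
      intro e
      split_ifs
      · rw [hload, hld]
      · simp
    rw [LinearMap.neg_apply, LinearMap.sum_apply] at h1
    simp only [LinearMap.smul_apply, hload, hld, smul_eq_mul, h4] at h1
    have h5 : 0 ≤ ∑ e, (P.V' e (s e) + if s e = 0 then c (Sum.inr e) else 0) * (g e - f t e) := by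
      simp only [add_mul, Finset.sum_add_distrib]
      linarith
    simp only [mul_sub, Finset.sum_sub_distrib] at h5
    linarith

end TEProblem

/-! ### Euclidean coordinates -/

theorem inner_toLp_eq_sum {J : Type*} [Fintype J] (a x : J → ℝ) :
    inner ℝ (WithLp.toLp 2 a : EuclideanSpace ℝ J) (WithLp.toLp 2 x) = ∑ e, a e * x e := by
  simp [PiLp.inner_apply, mul_comm]

theorem norm_toLp_le_sqrt {J : Type*} [Fintype J] {g : J → ℝ} {M : ℝ} (hg : ∀ e, |g e| ≤ M) :
    ‖(WithLp.toLp 2 g : EuclideanSpace ℝ J)‖ ≤ √(Fintype.card J * M ^ 2) := by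
  rw [EuclideanSpace.norm_eq]
  refine Real.sqrt_le_sqrt ?_
  calc ∑ e, ‖g e‖ ^ 2 ≤ ∑ _e : J, M ^ 2 :=
        Finset.sum_le_sum fun e _ => pow_le_pow_left₀ (norm_nonneg _) (hg e) 2
    _ = Fintype.card J * M ^ 2 := by rw [Finset.sum_const, nsmul_eq_mul, Finset.card_univ]

namespace TEProblem

variable {N J R : Type*} [DecidableEq N] [Fintype R] [Fintype J] {P : TEProblem N J R}

/-! ### The routing problems -/

/-- The optimality of a routing only depends on the set of links that it uses. -/
theorem SolvesRoute.of_support {t : N} {w g h : J → ℝ} (hg : P.SolvesRoute t w g)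
    (hh : P.IsRouting t h) (hsupp : ∀ e, g e = 0 → h e = 0) : P.SolvesRoute t w h := by
  have h1 := hg.cost_nonneg (x := g - h) (by rw [Matrix.mulVec_sub, hg.1.2, hh.2, sub_self])
    fun e he => by rw [Pi.sub_apply, he, hsupp e he, sub_zero]
  simp only [Pi.sub_apply, mul_sub, Finset.sum_sub_distrib] at h1
  exact ⟨hh, fun g' hg' => le_trans (by linarith) (hg.2 g' hg')⟩

theorem SolvesRoute.cost_eq {t : N} {w g h : J → ℝ} (hg : P.SolvesRoute t w g)
    (hh : P.SolvesRoute t w h) : ∑ e, w e * g e = ∑ e, w e * h e :=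
  le_antisymm (hg.2 h hh.1) (hh.2 g hg.1)

theorem le_cost_div {w g : J → ℝ} (hw : ∀ e, 0 < w e) (hg : ∀ e, 0 ≤ g e) (e : J) :
    g e ≤ (∑ e, w e * g e) / w e := by
  rw [le_div_iff₀ (hw e), mul_comm]
  exact Finset.single_le_sum (f := fun e => w e * g e)
    (fun e _ => mul_nonneg (hw e).le (hg e)) (Finset.mem_univ e)

theorem exists_solvesRoute {t : N} {w g : J → ℝ} (hw : ∀ e, 0 < w e) (hg : P.IsRouting t g) :
    ∃ h, P.SolvesRoute t w h := by
  have hc : Continuous fun h : J → ℝ => ∑ e, w e * h e := by fun_prop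
  set c := ∑ e, w e * g e with hcdef
  have hcomp : IsCompact ({h | P.IsRouting t h} ∩ {h | ∑ e, w e * h e ≤ c}) := by
    have hbox : IsCompact (Set.univ.pi fun e : J => Set.Icc (0 : ℝ) (c / w e)) :=
      isCompact_univ_pi fun _ => isCompact_Icc
    refine hbox.of_isClosed_subset
      ((P.isClosed_isRouting t).inter (isClosed_le hc continuous_const)) ?_
    rintro h ⟨hh, hle⟩ e -
    exact ⟨hh.1 e, (le_cost_div hw hh.1 e).trans (div_le_div_of_nonneg_right hle (hw e).le)⟩
  obtain ⟨h, hh, hmin⟩ := hcomp.exists_isMinOn ⟨g, hg, hcdef.ge⟩ hc.continuousOn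
  refine ⟨h, hh.1, fun g' hg' => ?_⟩
  by_cases hle : ∑ e, w e * g' e ≤ c
  · exact hmin ⟨hg', hle⟩
  · exact le_trans hh.2 (le_of_lt (not_le.1 hle))

/-- Cheapest routings for positive prices are bounded, uniformly in the prices. -/
theorem exists_bound_solvesRoute (P : TEProblem N J R) (t : N) :
    ∃ M, 0 < M ∧ ∀ w g : J → ℝ, (∀ e, 0 < w e) → P.SolvesRoute t w g → ∀ e, g e ≤ M := by
  classical
  -- All routings that use only links of `S` have the same cost, for some fixed positive prices.
  have key : ∀ p : Set J × J, ∃ M, ∀ w g : J → ℝ, (∀ e, 0 < w e) → P.SolvesRoute t w g →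
      {e | g e ≠ 0} = p.1 → g p.2 ≤ M := by
    rintro ⟨S, e⟩
    by_cases hS : ∃ w g : J → ℝ, (∀ e, 0 < w e) ∧ P.SolvesRoute t w g ∧ {e | g e ≠ 0} = S
    · obtain ⟨w, g, hw, hg, hgS⟩ := hS
      refine ⟨(∑ e, w e * g e) / w e, fun w' g' _ hg' hS' => ?_⟩
      have h1 : P.SolvesRoute t w g' := hg.of_support hg'.1 fun e he => by
        by_contra hne
        have h2 : e ∈ {e | g' e ≠ 0} := hne
        rw [hS', ← hgS] at h2
        exact h2 he
      rw [hg.cost_eq h1]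
      exact le_cost_div hw h1.1.1 e
    · exact ⟨0, fun w g hw hg hgS => absurd ⟨w, g, hw, hg, hgS⟩ hS⟩
  choose M hM using key
  obtain ⟨C, hC, hMC⟩ := exists_forall_le_of_finite M
  exact ⟨C, hC, fun w g hw hg e => (hM (_, e) w g hw hg rfl).trans (hMC _)⟩

/-- Finitely many routings suffice to test the optimality of `f₀` for all prices, and moreover to
span, together with `f₀`, all the cheapest routings. They are collected from the finitely many
faces of the polyhedron of routings. -/
theorem exists_test_routings (P : TEProblem N J R) (t : N) (f₀ : J → ℝ) :
    ∃ G : Finset (J → ℝ), (∀ g ∈ G, P.IsRouting t g) ∧ ∀ w g, P.SolvesRoute t w g →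
      (∃ h ∈ G, P.SolvesRoute t w h) ∧
      (WithLp.toLp 2 (f₀ - g) : EuclideanSpace ℝ J) ∈ Submodule.span ℝ
        ((fun h => (WithLp.toLp 2 (f₀ - h) : EuclideanSpace ℝ J)) ''
          {h | h ∈ G ∧ P.SolvesRoute t w h}) := by
  classical
  let φ : (J → ℝ) → EuclideanSpace ℝ J := fun h => WithLp.toLp 2 (f₀ - h)
  let Φ : Finset J → Set (J → ℝ) := fun S => {g | P.IsRouting t g ∧ ∀ e ∉ S, g e = 0}
  have key : ∀ S, ∃ F : Finset (J → ℝ), (F : Set (J → ℝ)) ⊆ Φ S ∧ ∀ g ∈ Φ S, F.Nonempty ∧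
      φ g ∈ Submodule.span ℝ (φ '' (F : Set (J → ℝ))) := by
    intro S
    rcases (Φ S).eq_empty_or_nonempty with hS | ⟨g₀, hg₀⟩
    · exact ⟨∅, by simp, fun g hg => by simp [hS] at hg⟩
    obtain ⟨F', hF', hspan⟩ := (Submodule.fg_span_iff_fg_span_finset_subset (φ '' Φ S)).1
      (IsNoetherian.noetherian (R := ℝ) _)
    obtain ⟨F, hF, rfl⟩ := Finset.subset_set_image_iff.1 hF'
    refine ⟨insert g₀ F, ?_, fun g hg => ⟨Finset.insert_nonempty _ _, ?_⟩⟩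
    · rw [Finset.coe_insert]
      exact Set.insert_subset hg₀ hF
    · have h1 : φ g ∈ Submodule.span ℝ (φ '' Φ S) :=
        Submodule.subset_span (Set.mem_image_of_mem _ hg)
      rw [hspan, Finset.coe_image] at h1
      refine Submodule.span_mono (Set.image_mono ?_) h1
      rw [Finset.coe_insert]
      exact Set.subset_insert _ _
  choose F hF hFspan using key
  refine ⟨Finset.univ.biUnion F, fun g hg => ?_, fun w g hg => ?_⟩
  · obtain ⟨S, -, hgS⟩ := Finset.mem_biUnion.1 hg
    exact (hF S hgS).1
  · set S : Finset J := {e | g e ≠ 0} with hS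
    obtain ⟨⟨h, hh⟩, hspan⟩ := hFspan S g ⟨hg.1, fun e he => by simpa [hS] using he⟩
    have hmem : ∀ h ∈ F S, h ∈ Finset.univ.biUnion F ∧ P.SolvesRoute t w h := fun h hh =>
      ⟨Finset.mem_biUnion.2 ⟨S, Finset.mem_univ _, hh⟩,
        hg.of_support (hF S hh).1 fun e he => (hF S hh).2 e (by simp [hS, he])⟩
    exact ⟨⟨h, hmem h hh⟩, Submodule.span_mono (Set.image_mono hmem) hspan⟩

/-! ### The set of dual optimal prices -/

theorem isClosed_isEquilibrium (P : TEProblem N J R) (s : J → ℝ) (f : N → J → ℝ) :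
    IsClosed {w | P.IsEquilibrium s f w} := by
  have h1 : IsClosed {w : J → ℝ | ∀ e, P.V' e (s e) ≤ w e} := by
    simp only [Set.ofPred_forall]
    exact isClosed_iInter fun e => isClosed_le continuous_const (continuous_apply e)
  have h2 : IsClosed {w : J → ℝ | ∀ e, 0 < s e → P.V' e (s e) = w e} := by
    simp only [Set.ofPred_forall]
    exact isClosed_iInter fun e => isClosed_iInter fun _ =>
      isClosed_eq continuous_const (continuous_apply e)
  have h3 : IsClosed {w : J → ℝ | ∀ t ∈ P.dests, P.IsRouting t (f t)} := isClosed_const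
  have h4 : IsClosed {w : J → ℝ | ∀ t ∈ P.dests, ∀ g, P.IsRouting t g →
      ∑ e, w e * f t e ≤ ∑ e, w e * g e} := by
    simp only [Set.ofPred_forall]
    exact isClosed_iInter fun t => isClosed_iInter fun _ => isClosed_iInter fun g =>
      isClosed_iInter fun _ => isClosed_le (by fun_prop) (by fun_prop)
  convert h1.inter (h2.inter (h3.inter h4)) using 1
  ext w
  exact ⟨fun h => ⟨h.deriv_le, h.deriv_eq, fun t ht => (h.route t ht).1,
    fun t ht => (h.route t ht).2⟩, fun h => ⟨h.1, h.2.1, fun t ht => ⟨h.2.2.1 t ht, h.2.2.2 t ht⟩⟩⟩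

/-- Hoffman's error bound for the polyhedron of dual optimal prices, which is cut out by the
first-order conditions of the links and the comparison of the routings `f t` with the test
routings. -/
theorem exists_isEquilibrium_near (hU : ∀ e, IsUtility (P.dom e) (P.V e) (P.V' e)) {s : J → ℝ}
    {f : N → J → ℝ} (hf : P.Feasible s f) (heq : ∃ w, P.IsEquilibrium s f w)
    {G : N → Finset (J → ℝ)} (hG : ∀ t, ∀ g ∈ G t, P.IsRouting t g)
    (htest : ∀ t w g, P.SolvesRoute t w g → ∃ h ∈ G t, P.SolvesRoute t w h) :
    ∃ C > 0, ∀ (w : J → ℝ) (δ : ℝ), 0 ≤ δ → (∀ e, P.V' e (s e) - w e ≤ δ) →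
      (∀ e, 0 < s e → w e - P.V' e (s e) ≤ δ) →
      (∀ t ∈ P.dests, ∀ g ∈ G t, ∑ e, w e * f t e - ∑ e, w e * g e ≤ δ) →
      ∃ p, P.IsEquilibrium s f p ∧
        ‖(WithLp.toLp 2 w : EuclideanSpace ℝ J) - WithLp.toLp 2 p‖ ≤ C * δ := by
  classical
  let a : J ⊕ J ⊕ (Σ t : P.dests, G t) → EuclideanSpace ℝ J :=
    Sum.elim (fun e => WithLp.toLp 2 (-Pi.single e 1))
      (Sum.elim (fun e => WithLp.toLp 2 (if 0 < s e then Pi.single e 1 else 0))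
        fun p => WithLp.toLp 2 (f p.1 - (p.2 : J → ℝ)))
  let b : J ⊕ J ⊕ (Σ t : P.dests, G t) → ℝ :=
    Sum.elim (fun e => -P.V' e (s e)) (Sum.elim (fun e => if 0 < s e then P.V' e (s e) else 0) 0)
  have hiff : ∀ (w : J → ℝ) (δ : ℝ), 0 ≤ δ →
      ((∀ i, inner ℝ (a i) (WithLp.toLp 2 w) ≤ b i + δ) ↔ (∀ e, P.V' e (s e) - w e ≤ δ) ∧
        (∀ e, 0 < s e → w e - P.V' e (s e) ≤ δ) ∧
        ∀ t ∈ P.dests, ∀ g ∈ G t, ∑ e, w e * f t e - ∑ e, w e * g e ≤ δ) := by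
    intro w δ hδ
    have h1 : ∀ e, inner ℝ (a (Sum.inl e)) (WithLp.toLp 2 w) = -w e := fun e => by
      simp only [a, Sum.elim_inl]
      rw [inner_toLp_eq_sum]
      simp [Pi.single_apply]
    have h2 : ∀ e, inner ℝ (a (Sum.inr (Sum.inl e))) (WithLp.toLp 2 w) =
        if 0 < s e then w e else 0 := fun e => by
      simp only [a, Sum.elim_inl, Sum.elim_inr]
      rw [inner_toLp_eq_sum]
      split_ifs <;> simp [Pi.single_apply]
    have h3 : ∀ p, inner ℝ (a (Sum.inr (Sum.inr p))) (WithLp.toLp 2 w) =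
        ∑ e, w e * f p.1 e - ∑ e, w e * (p.2 : J → ℝ) e := fun p => by
      simp only [a, Sum.elim_inr]
      rw [inner_toLp_eq_sum, ← Finset.sum_sub_distrib]
      exact Finset.sum_congr rfl fun e _ => by rw [Pi.sub_apply]; ring
    constructor
    · intro h
      refine ⟨fun e => ?_, fun e he => ?_, fun t ht g hg => ?_⟩
      · have := h (Sum.inl e)
        rw [h1] at this
        simp only [b, Sum.elim_inl] at this
        linarith
      · have := h (Sum.inr (Sum.inl e))
        rw [h2] at this
        simp only [b, Sum.elim_inl, Sum.elim_inr, if_pos he] at this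
        linarith
      · have := h (Sum.inr (Sum.inr ⟨⟨t, ht⟩, ⟨g, hg⟩⟩))
        rw [h3] at this
        simpa [b] using this
    · rintro ⟨k1, k2, k3⟩ (e | e | p)
      · rw [h1]
        simp only [b, Sum.elim_inl]
        linarith [k1 e]
      · rw [h2]
        simp only [b, Sum.elim_inl, Sum.elim_inr]
        split_ifs with he
        · linarith [k2 e he]
        · linarith
      · rw [h3]
        simpa [b] using k3 p.1 p.1.2 p.2 p.2.2
  have hpoly : ∀ p : J → ℝ, (∀ i, inner ℝ (a i) (WithLp.toLp 2 p) ≤ b i) →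
      P.IsEquilibrium s f p := by
    intro p hp
    obtain ⟨k1, k2, k3⟩ := (hiff p 0 le_rfl).1 fun i => by rw [add_zero]; exact hp i
    have hle : ∀ e, P.V' e (s e) ≤ p e := fun e => by linarith [k1 e]
    refine ⟨hle, fun e he => le_antisymm (hle e) (by linarith [k2 e he]), fun t ht => ?_⟩
    obtain ⟨g, hg⟩ := exists_solvesRoute
      (fun e => ((hU e).pos _ (hf.mem_dom e)).trans_le (hle e)) (hf.routing t ht)
    obtain ⟨h, hh, hsol⟩ := htest t p g hg
    exact ⟨hf.routing t ht, fun g' hg' => le_trans (by linarith [k3 t ht h hh]) (hsol.2 g' hg')⟩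
  obtain ⟨w₀, hw₀⟩ := heq
  obtain ⟨C, hC, hbound⟩ := hoffman_bound a b ⟨WithLp.toLp 2 w₀, fun i => by
    have := (hiff w₀ 0 le_rfl).2 ⟨fun e => by linarith [hw₀.deriv_le e],
      fun e he => by linarith [hw₀.deriv_eq e he],
      fun t ht g hg => by linarith [(hw₀.route t ht).2 g (hG t g hg)]⟩ i
    rwa [add_zero] at this⟩
  refine ⟨C, hC, fun w δ hδ k1 k2 k3 => ?_⟩
  obtain ⟨p, hp, hdist⟩ := hbound (WithLp.toLp 2 w) δ hδ ((hiff w δ hδ).2 ⟨k1, k2, k3⟩)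
  exact ⟨p.ofLp, hpoly _ hp, hdist⟩

end TEProblem

namespace TEProblem

variable {N J R : Type*} [DecidableEq N] [Fintype R] [Fintype J] {P : TEProblem N J R}

/-! ### The optimality gap -/

/-- The excess of the dual function at the prices `w`, where the link and routing problems have the
solutions `x` and `g`, over its minimal value, which is attained at an optimal solution `(s, f)`. -/
def dualGap (P : TEProblem N J R) (s : J → ℝ) (f : N → J → ℝ) (w x : J → ℝ) (g : N → J → ℝ) : ℝ :=
  ∑ e, ((P.V e (x e) - w e * x e) - (P.V e (s e) - w e * s e)) +
    ∑ t ∈ P.dests, (∑ e, w e * f t e - ∑ e, w e * g t e)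

section Gap

variable {s w x : J → ℝ} {f g : N → J → ℝ}

theorem link_gap_le_dualGap (hf : P.Feasible s f) (hx : ∀ e, P.SolvesLink e (w e) (x e))
    (hg : ∀ t ∈ P.dests, P.SolvesRoute t w (g t)) (e : J) :
    (P.V e (x e) - w e * x e) - (P.V e (s e) - w e * s e) ≤ P.dualGap s f w x g := by
  have h1 := Finset.single_le_sum
    (f := fun e => (P.V e (x e) - w e * x e) - (P.V e (s e) - w e * s e))
    (fun e _ => sub_nonneg.2 ((hx e).2 _ (hf.mem_dom e))) (Finset.mem_univ e)
  have h2 : 0 ≤ ∑ t ∈ P.dests, (∑ e, w e * f t e - ∑ e, w e * g t e) :=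
    Finset.sum_nonneg fun t ht => sub_nonneg.2 ((hg t ht).2 _ (hf.routing t ht))
  exact h1.trans (le_add_of_nonneg_right h2)

theorem route_gap_le_dualGap (hf : P.Feasible s f) (hx : ∀ e, P.SolvesLink e (w e) (x e))
    (hg : ∀ t ∈ P.dests, P.SolvesRoute t w (g t)) {t : N} (ht : t ∈ P.dests) :
    ∑ e, w e * f t e - ∑ e, w e * g t e ≤ P.dualGap s f w x g := by
  have h1 := Finset.single_le_sum (f := fun t => ∑ e, w e * f t e - ∑ e, w e * g t e)
    (fun t ht => sub_nonneg.2 ((hg t ht).2 _ (hf.routing t ht))) ht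
  have h2 : 0 ≤ ∑ e, ((P.V e (x e) - w e * x e) - (P.V e (s e) - w e * s e)) :=
    Finset.sum_nonneg fun e _ => sub_nonneg.2 ((hx e).2 _ (hf.mem_dom e))
  exact h1.trans (le_add_of_nonneg_left h2)

/-- The subgradient inequality of the dual function. -/
theorem dualGap_le (hU : ∀ e, IsUtility (P.dom e) (P.V e) (P.V' e)) (hf : P.Feasible s f)
    {p : J → ℝ} (hp : P.IsEquilibrium s f p) (hx : ∀ e, P.SolvesLink e (w e) (x e))
    (hg : ∀ t ∈ P.dests, P.SolvesRoute t w (g t)) :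
    P.dualGap s f w x g ≤ ∑ e, (P.cap e - P.load g e - x e) * (w e - p e) := by
  have h1 : ∀ e, (P.V e (x e) - w e * x e) - (P.V e (s e) - w e * s e) ≤
      (s e - x e) * (w e - p e) := by
    intro e
    have := (hU e).isMax_of_deriv (hf.mem_dom e) (hp.deriv_le e) (hp.deriv_eq e) (hx e).1
    linarith
  have h2 : ∑ e, p e * P.load f e ≤ ∑ e, p e * P.load g e := by
    rw [sum_mul_load, sum_mul_load]
    exact Finset.sum_le_sum fun t ht => (hp.route t ht).2 _ (hg t ht).1
  have h3 : ∑ e, (P.cap e - P.load g e - x e) * (w e - p e) =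
      ∑ e, (s e - x e) * (w e - p e) + (∑ e, w e * P.load f e - ∑ e, w e * P.load g e) +
        (∑ e, p e * P.load g e - ∑ e, p e * P.load f e) := by
    simp only [← Finset.sum_sub_distrib, ← Finset.sum_add_distrib]
    exact Finset.sum_congr rfl fun e _ => by rw [← hf.spare]; ring
  rw [h3, sum_mul_load P w, sum_mul_load P w, dualGap, Finset.sum_sub_distrib (s := P.dests)]
  have := Finset.sum_le_sum fun e (_ : e ∈ Finset.univ) => h1 e
  linarith

end Gap

/-! ### Runs of the algorithm -/

namespace IsRun

variable {γ : ℕ → ℝ} {w s : ℕ → J → ℝ} {f : ℕ → N → J → ℝ}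

theorem deriv_le (hU : ∀ e, IsUtility (P.dom e) (P.V e) (P.V' e)) (h : P.IsRun γ w s f) (k : ℕ)
    (e : J) : P.V' e (s k e) ≤ w k e :=
  (hU e).deriv_le_of_isMax (h.link k e).1 (h.link k e).2

theorem price_pos (hU : ∀ e, IsUtility (P.dom e) (P.V e) (P.V' e)) (h : P.IsRun γ w s f) (k : ℕ)
    (e : J) : 0 < w k e :=
  ((hU e).pos _ (h.link k e).1).trans_le (h.deriv_le hU k e)

/-- The projection in the update step is never active, since the link problems are only solvable at
positive prices. -/
theorem update_eq (hU : ∀ e, IsUtility (P.dom e) (P.V e) (P.V' e)) (h : P.IsRun γ w s f) (k : ℕ)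
    (e : J) : w (k + 1) e = w k e - γ k * (P.cap e - P.load (f k) e - s k e) := by
  have h1 := h.price_pos hU (k + 1) e
  rw [h.update] at h1 ⊢
  refine max_eq_left ?_
  by_contra! hneg
  rw [max_eq_right hneg.le] at h1
  exact lt_irrefl _ h1

theorem load_nonneg (h : P.IsRun γ w s f) (k : ℕ) (e : J) : 0 ≤ P.load (f k) e :=
  Finset.sum_nonneg fun t ht => (h.route k t ht).1.1 e

/-- The spare capacities remain bounded: a price decreases only as long as the link asks for less
spare capacity than its capacity, and then the price is at least the marginal utility at the
capacity, so that a small step leaves it above the marginal utility at one unit more. -/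
theorem exists_spare_le (hU : ∀ e, IsUtility (P.dom e) (P.V e) (P.V' e)) (h : P.IsRun γ w s f)
    (hγ : ∀ k, 0 ≤ γ k) (hγ0 : Tendsto γ atTop (𝓝 0)) {e : J} (hcap : 0 ≤ P.cap e) :
    ∃ σ, ∀ᶠ k in atTop, s k e ≤ σ := by
  have hc1 : P.cap e + 1 ∈ P.dom e := (hU e).mem_of_pos (by linarith)
  -- If `cap e = 0`, the price never decreases.
  have hdrop : ∀ᶠ k in atTop, ∀ x ∈ P.dom e, x < P.cap e →
      γ k * P.cap e ≤ P.V' e x - P.V' e (P.cap e + 1) := by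
    rcases hcap.eq_or_lt with h0 | h0
    · exact Eventually.of_forall fun k x hx hlt =>
        absurd ((hU e).nonneg hx) (not_le.2 (by rwa [← h0] at hlt))
    · have h1 := (hU e).deriv_lt ((hU e).mem_of_pos h0) (lt_add_one _)
      have h2 : Tendsto (fun k => γ k * P.cap e) atTop (𝓝 0) := by
        simpa using hγ0.mul_const (P.cap e)
      filter_upwards [h2.eventually_le_const (sub_pos.2 h1)] with k hk x hx hlt
      have := (hU e).deriv_le hx hlt.le
      linarith
  obtain ⟨K, hK⟩ := eventually_atTop.1 hdrop
  set σ := max (s K e) (P.cap e + 1) with hσ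
  have hσD : σ ∈ P.dom e := (hU e).mem_of_le hc1 (le_max_right _ _)
  have hσ1 : P.V' e σ ≤ P.V' e (P.cap e + 1) := (hU e).deriv_le hc1 (le_max_right _ _)
  have inv : ∀ k ≥ K, P.V' e σ ≤ w k e := by
    intro k hk
    induction k, hk using Nat.le_induction with
    | base =>
      exact ((hU e).deriv_le (h.link K e).1 (le_max_left _ _)).trans (h.deriv_le hU K e)
    | succ k hk ih =>
      rw [h.update_eq hU]
      have h1 := mul_nonneg (hγ k) (h.load_nonneg k e)
      have h2 := h.link k e
      have h3 := mul_nonneg (hγ k) ((hU e).nonneg h2.1)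
      rcases le_or_gt (P.cap e) (s k e) with hle | hlt
      · have := mul_nonneg (hγ k) (sub_nonneg.2 hle)
        linarith
      · have h4 := hK k hk _ h2.1 hlt
        have h5 := h.deriv_le hU k e
        linarith
  refine ⟨σ, eventually_atTop.2 ⟨K, fun k hk => ?_⟩⟩
  by_contra! hlt
  have h1 := (hU e).deriv_eq_of_isMax (((hU e).nonneg hσD).trans_lt hlt) (h.link k e).2
  have h2 := (hU e).deriv_lt hσD hlt
  linarith [inv k hk]

theorem exists_abs_excess_le (hU : ∀ e, IsUtility (P.dom e) (P.V e) (P.V' e))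
    (h : P.IsRun γ w s f) (hγ : ∀ k, 0 ≤ γ k) (hγ0 : Tendsto γ atTop (𝓝 0))
    (hcap : ∀ e, 0 ≤ P.cap e) :
    ∃ M, ∀ᶠ k in atTop, ∀ e, |P.cap e - P.load (f k) e - s k e| ≤ M := by
  choose σ hσ using fun e => h.exists_spare_le hU hγ hγ0 (hcap e)
  choose F hF0 hF using P.exists_bound_solvesRoute
  obtain ⟨A, hA, hcA⟩ := exists_forall_le_of_finite P.cap
  obtain ⟨B, hB, hσB⟩ := exists_forall_le_of_finite σ
  have hFs : 0 ≤ ∑ t ∈ P.dests, F t := Finset.sum_nonneg fun t _ => (hF0 t).le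
  refine ⟨A + ∑ t ∈ P.dests, F t + B, ?_⟩
  filter_upwards [eventually_all.2 hσ] with k hk e
  have h1 := h.load_nonneg k e
  have h2 : P.load (f k) e ≤ ∑ t ∈ P.dests, F t :=
    Finset.sum_le_sum fun t ht => hF t (w k) _ (h.price_pos hU k) (h.route k t ht) e
  have h3 := (hU e).nonneg (h.link k e).1
  have h4 := (hk e).trans (hσB e)
  have h5 := hcA e
  have h6 := hcap e
  rw [abs_le]
  constructor <;> linarith

open Metric in
/-- The prices of a run converge. First, they approach the polyhedron of dual optimal prices.
Then the links and the routings that change the prices are those whose first-order conditions, or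
whose optimality conditions, are nearly tight, and there are only finitely many such conditions. -/
theorem exists_tendsto (hU : ∀ e, IsUtility (P.dom e) (P.V e) (P.V' e))
    (h : P.IsRun γ w s f) (hγ : ∀ k, 0 ≤ γ k)
    (hsum : Tendsto (fun n => ∑ k ∈ Finset.range n, γ k) atTop atTop)
    (hγ0 : Tendsto γ atTop (𝓝 0)) {s₀ : J → ℝ} {f₀ : N → J → ℝ} (hf₀ : P.Feasible s₀ f₀)
    (heq : ∃ p, P.IsEquilibrium s₀ f₀ p) :
    ∃ p, P.IsEquilibrium s₀ f₀ p ∧ Tendsto w atTop (𝓝 p) := by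
  classical
  let x : ℕ → EuclideanSpace ℝ J := fun k => WithLp.toLp 2 (w k)
  let g : ℕ → EuclideanSpace ℝ J := fun k =>
    WithLp.toLp 2 fun e => P.cap e - P.load (f k) e - s k e
  let gap : ℕ → ℝ := fun k => P.dualGap s₀ f₀ (w k) (s k) (f k)
  let W : Set (EuclideanSpace ℝ J) := {p | P.IsEquilibrium s₀ f₀ p.ofLp}
  have hW : IsClosed W :=
    IsClosed.preimage (PiLp.continuous_ofLp 2 fun _ : J => ℝ) (P.isClosed_isEquilibrium s₀ f₀)
  have hWne : W.Nonempty := by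
    obtain ⟨p, hp⟩ := heq
    exact ⟨WithLp.toLp 2 p, hp⟩
  have hx : ∀ k, x (k + 1) = x k - γ k • g k := by
    intro k
    ext e
    exact h.update_eq hU k e
  have hcap : ∀ e, 0 ≤ P.cap e := fun e =>
    ((hU e).nonneg (hf₀.mem_dom e)).trans (hf₀.spare_le_cap e)
  obtain ⟨M, hM⟩ := h.exists_abs_excess_le hU hγ hγ0 hcap
  obtain ⟨B, hG⟩ : ∃ B, ∀ᶠ k in atTop, ‖g k‖ ≤ B := ⟨_, hM.mono fun k hk => norm_toLp_le_sqrt hk⟩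
  have hsub : ∀ k, ∀ p ∈ W, gap k ≤ inner ℝ (g k) (x k - p) := fun k p hp =>
    (dualGap_le hU hf₀ hp (h.link k) (h.route k)).trans_eq
      (inner_toLp_eq_sum (fun e => P.cap e - P.load (f k) e - s k e) (w k - p.ofLp)).symm
  choose G hGr hGtest using fun t => P.exists_test_routings t (f₀ t)
  have hlink : ∀ δ > 0, ∃ η > 0, ∀ k, gap k ≤ η → ∀ e, P.V' e (s₀ e) - w k e ≤ δ ∧
      (0 < s₀ e → w k e - P.V' e (s₀ e) ≤ δ) := by
    intro δ hδ
    choose η hη hη' using fun e => (hU e).price_near_of_gap_le (hf₀.mem_dom e) hδ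
    obtain ⟨c, hc, hcη⟩ := exists_pos_forall_le η hη
    exact ⟨c, hc, fun k hk e => hη' e _ _ (h.link k e).2
      ((link_gap_le_dualGap hf₀ (h.link k) (h.route k) e).trans (hk.trans (hcη e)))⟩
  obtain ⟨C, hC, hnear⟩ := exists_isEquilibrium_near hU hf₀ heq hGr
    fun t w g hg => (hGtest t w g hg).1
  have hgrowth : ∀ δ > 0, ∃ η > 0, ∀ k, gap k ≤ η → infDist (x k) W ≤ δ := by
    intro δ hδ
    obtain ⟨η, hη, hη'⟩ := hlink (δ / C) (by positivity)
    refine ⟨min η (δ / C), lt_min hη (by positivity), fun k hk => ?_⟩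
    have h1 := hη' k (hk.trans (min_le_left _ _))
    obtain ⟨p, hp, hdist⟩ := hnear (w k) (δ / C) (by positivity) (fun e => (h1 e).1)
      (fun e => (h1 e).2) fun t ht r hr => by
        have h2 := route_gap_le_dualGap hf₀ (h.link k) (h.route k) ht
        have h3 := (h.route k t ht).2 r (hGr t r hr)
        have h4 := hk.trans (min_le_right _ _)
        have h5 : P.dualGap s₀ f₀ (w k) (s k) (f k) ≤ δ / C := h4
        linarith
    rw [mul_div_cancel₀ _ hC.ne'] at hdist
    refine (infDist_le_dist_of_mem (show WithLp.toLp 2 p ∈ W from hp)).trans ?_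
    rw [dist_eq_norm]
    exact hdist
  have hdist := tendsto_infDist_of_subgradient_steps hW hWne hγ hsum hγ0 hx hG hsub hgrowth
  have hgap : ∀ η > 0, ∀ᶠ k in atTop, gap k ≤ η := by
    intro η hη
    have h1 : Tendsto (fun k => B * infDist (x k) W) atTop (𝓝 0) := by
      simpa using hdist.const_mul B
    filter_upwards [hG, h1.eventually_le_const hη] with k hk hkη
    obtain ⟨p, hp, hpd⟩ := hW.exists_infDist_eq_dist hWne (x k)
    refine (hsub k p hp).trans ((real_inner_le_norm _ _).trans (le_trans ?_ hkη))
    rw [hpd, dist_eq_norm]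
    exact mul_le_mul_of_nonneg_right hk (norm_nonneg _)
  have hstep : Tendsto (fun k => ‖x (k + 1) - x k‖) atTop (𝓝 0) := by
    have h1 : Tendsto (fun k => γ k * B) atTop (𝓝 0) := by
      simpa using hγ0.mul_const B
    refine squeeze_zero' (Eventually.of_forall fun k => norm_nonneg _) ?_ h1
    filter_upwards [hG] with k hk
    rw [hx, sub_sub_cancel_left, norm_neg, norm_smul, Real.norm_eq_abs, abs_of_nonneg (hγ k)]
    exact mul_le_mul_of_nonneg_left hk (hγ k)
  let a : J ⊕ (Σ t : P.dests, G t) → EuclideanSpace ℝ J :=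
    Sum.elim (fun e => WithLp.toLp 2 (Pi.single e 1))
      fun p => WithLp.toLp 2 (f₀ p.1 - (p.2 : J → ℝ))
  let b : J ⊕ (Σ t : P.dests, G t) → ℝ := Sum.elim (fun e => P.V' e (s₀ e)) 0
  have hspan : ∀ ε > 0, ∀ᶠ k in atTop, x (k + 1) - x k ∈
      Submodule.span ℝ (a '' {i | |inner ℝ (a i) (x k) - b i| ≤ ε}) := by
    intro ε hε
    obtain ⟨η, hη, hη'⟩ := hlink ε hε
    filter_upwards [hgap η hη, hgap ε hε] with k hk hkε
    have hdecomp : g k = ∑ e, (s₀ e - s k e) • a (Sum.inl e) +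
        ∑ t ∈ P.dests, WithLp.toLp 2 (f₀ t - f k t) := by
      ext e
      have h1 : (∑ e', (s₀ e' - s k e') • a (Sum.inl e')) e = s₀ e - s k e := by
        simp [a, Pi.single_apply]
      have h2 : (∑ t ∈ P.dests, WithLp.toLp 2 (f₀ t - f k t) : EuclideanSpace ℝ J) e =
          P.load f₀ e - P.load (f k) e := by
        simp [load]
      rw [PiLp.add_apply, h1, h2, ← hf₀.spare]
      change P.cap e - P.load (f k) e - s k e = _
      ring
    rw [hx, sub_sub_cancel_left]
    refine neg_mem (Submodule.smul_mem _ _ ?_)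
    rw [hdecomp]
    refine add_mem (sum_mem fun e _ => ?_) (sum_mem fun t ht => ?_)
    · by_cases hs : s k e = s₀ e
      · rw [hs, sub_self, zero_smul]
        exact zero_mem _
      refine Submodule.smul_mem _ _ (Submodule.subset_span ⟨Sum.inl e, ?_, rfl⟩)
      have h1 : inner ℝ (a (Sum.inl e)) (x k) = w k e := by
        simp only [a, x, Sum.elim_inl]
        rw [inner_toLp_eq_sum]
        simp [Pi.single_apply]
      change |inner ℝ (a (Sum.inl e)) (x k) - P.V' e (s₀ e)| ≤ ε
      rw [h1, abs_sub_le_iff]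
      obtain ⟨h2, h3⟩ := hη' k hk e
      refine ⟨?_, h2⟩
      rcases ((hU e).nonneg (hf₀.mem_dom e)).eq_or_lt with h0 | h0
      · -- A saturated link with `s k e ≠ 0` has a price below its marginal utility at zero.
        have h4 : 0 < s k e := lt_of_le_of_ne ((hU e).nonneg (h.link k e).1)
          fun h5 => hs (by rw [← h5, ← h0])
        have h5 := (hU e).deriv_eq_of_isMax h4 (h.link k e).2
        have h6 := (hU e).deriv_le (hf₀.mem_dom e) (h0 ▸ h4.le : s₀ e ≤ s k e)
        linarith
      · exact h3 h0
    · refine Submodule.span_mono ?_ (hGtest t (w k) (f k t) (h.route k t ht)).2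
      rintro _ ⟨r, ⟨hr, hrsol⟩, rfl⟩
      refine ⟨Sum.inr ⟨⟨t, ht⟩, ⟨r, hr⟩⟩, ?_, rfl⟩
      have h1 : inner ℝ (a (Sum.inr ⟨⟨t, ht⟩, ⟨r, hr⟩⟩)) (x k) =
          ∑ e, w k e * f₀ t e - ∑ e, w k e * r e := by
        simp only [a, x, Sum.elim_inr]
        rw [inner_toLp_eq_sum, ← Finset.sum_sub_distrib]
        exact Finset.sum_congr rfl fun e _ => by rw [Pi.sub_apply]; ring
      change |inner ℝ (a (Sum.inr ⟨⟨t, ht⟩, ⟨r, hr⟩⟩)) (x k) - 0| ≤ ε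
      rw [h1, sub_zero, abs_of_nonneg (sub_nonneg.2 (hrsol.2 _ (hf₀.routing t ht))),
        hrsol.cost_eq (h.route k t ht)]
      exact (route_gap_le_dualGap hf₀ (h.link k) (h.route k) ht).trans hkε
  obtain ⟨p, hp⟩ := cauchySeq_tendsto_of_complete
    (cauchySeq_of_steps_mem_span_tight a b x hstep hspan)
  refine ⟨p.ofLp, ?_, ((PiLp.continuous_ofLp 2 fun _ : J => ℝ).tendsto p).comp hp⟩
  have h1 : infDist p W = 0 :=
    tendsto_nhds_unique (((continuous_infDist_pt W).tendsto p).comp hp) hdist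
  exact (hW.mem_iff_infDist_zero hWne).2 h1

end IsRun

end TEProblem

theorem theorem4 {N J R : Type*} [Fintype N] [DecidableEq N] [Fintype J] [Fintype R]
    (P : TEProblem N J R)
    (hdemand : ∀ r, 0 ≤ P.demand r)
    (hutility : ∀ e, IsUtility (P.dom e) (P.V e) (P.V' e))
    (hfeas : ∃ s f, P.Feasible s f) :
    ∃ sStar : J → ℝ, P.SolvesTE sStar ∧ (∀ s, P.SolvesTE s → s = sStar) ∧
      (∀ (γ : ℕ → ℝ) (w s : ℕ → J → ℝ) (f : ℕ → N → J → ℝ),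
        P.IsRun γ w s f → (∀ k, 0 ≤ γ k) →
        Tendsto (fun n => ∑ k ∈ Finset.range n, γ k) atTop atTop →
        Tendsto γ atTop (𝓝 0) →
        ∃ wStar : J → ℝ, P.IsFirstWeights wStar ∧ Tendsto w atTop (𝓝 wStar)) ∧
      ((∀ e, 0 < sStar e) →
        ∃ wStar : J → ℝ, P.IsFirstWeights wStar ∧
          (∀ w, P.IsFirstWeights w → w = wStar) ∧
          (∀ e, P.V' e (sStar e) = wStar e ∧
            ∀ x ∈ P.dom e, P.V' e x = wStar e → x = sStar e) ∧
          (∀ F : J → ℝ, P.IsOptimalTraffic F ↔ F = fun e => P.cap e - sStar e)) := by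
  obtain ⟨s₀, f₀, hopt⟩ := TEProblem.exists_isOptimal hutility hfeas
  obtain ⟨p₀, hp₀⟩ := hopt.exists_isEquilibrium hutility
  refine ⟨s₀, ⟨f₀, hopt⟩, fun s ⟨f, hf⟩ => hf.spare_unique hutility hopt, ?_, fun hpos => ?_⟩
  · intro γ w s f hrun hγ hsum hγ0
    obtain ⟨p, hp, hlim⟩ := hrun.exists_tendsto hutility hγ hsum hγ0 hopt.1 ⟨p₀, hp₀⟩
    exact ⟨p, hp.isFirstWeights hopt.1, hlim⟩
  · refine ⟨p₀, hp₀.isFirstWeights hopt.1, fun w hw => ?_, fun e => ⟨hp₀.deriv_eq e (hpos e), ?_⟩,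
      fun F => ⟨?_, ?_⟩⟩
    · obtain ⟨s, f, hf, heq⟩ := hw.exists_isEquilibrium hutility
      obtain rfl : s = s₀ := (heq.isOptimal hutility hf).spare_unique hutility hopt
      funext e
      rw [← heq.deriv_eq e (hpos e), hp₀.deriv_eq e (hpos e)]
    · intro x hx hxe
      exact (hutility e).deriv_injOn hx (hopt.1.mem_dom e)
        (hxe.trans (hp₀.deriv_eq e (hpos e)).symm)
    · rintro ⟨s, f, hf, rfl⟩
      funext e
      rw [← hf.spare_unique hutility hopt, ← hf.1.spare]
      ring
    · rintro rfl
      exact ⟨s₀, f₀, hopt, funext fun e => by rw [← hopt.1.spare]; ring⟩
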